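/- Let $\mathcal A$ be a finite set of assets with $|\mathcal A|>2$; inventories are vectors $I\in\mathbb R_+^{\mathcal A}=[0,\infty)^{\mathcal A}$, and $I>0$ means that $I_A>0$ for all $A\in\mathcal A$. A trading function is a function $f:\mathbb R_+^{\mathcal A}\to\mathbb R$ that is strictly increasing in all variables on $\{I: I>0\}$ and such that for each $J\in\mathbb R_+^{\mathcal A}$ the sets $\{I:f(I)\ge f(J)\}$ and $\{I:f(I)\le f(J)\}$ are closed. Functions $f,g$ on $\mathbb R_+^{\mathcal A}$ are equivalent if $f(I)=f(J)\Leftrightarrow g(I)=g(J)$ for all $I,J\in\mathbb R_+^{\mathcal A}$. Consider the following properties of $f$. - Independence: for each $\mathcal B\subseteq\mathcal A$ and all inventories $I,J>0$, $f(I_{\mathcal B},J_{-\mathcal B})=f(J)\Leftrightarrow f(I)=f(J_{\mathcal B},I_{-\mathcal B})$. - Scale invariance: for all $I,J\in\mathbb R_+^{\mathcal A}$ and $\lambda>0$, $f(I)=f(J)\Rightarrow f(\lambda I)=f(\lambda J)$. - Aversion to permanent loss: for each $J\in\mathbb R_+^{\mathcal A}$ the set $\{I:f(I)\ge f(J)\}$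 is convex. - Sufficient funds: for all $I,J\in\mathbb R_+^{\mathcal A}$ with $f(I)=f(J)$, $I>0$ implies $J>0$. A CEMM with parameter $\gamma\in\mathbb R$ is a function $g(I)=c\left(\sum_{A}\alpha_A I_A^\gamma\right)^{1/\gamma}$ if $\gamma\ne0$, and $g(I)=c\prod_A I_A^{\alpha_A}$ if $\gamma=0$, with constants $c>0$, $\alpha_A>0$, $\sum_A\alpha_A=1$; for $\gamma<0$ it is understood that $g(I)=0$ if $I_A=0$ for some $A$. Its inventory elasticity is $\frac1{1-\gamma}$, which is called positive if $\gamma\le1$ (it is infinite for $\gamma=1$). Then a trading function $f$ 1. satisfies independence, scale invariance and aversion to permanent loss if and only if it is equivalent to a CEMM with positive inventory elasticity; 2. satisfies independence, scale invariance and sufficient funds if and only if it is equivalent to a CEMM with inventory elasticity $0<\frac1{1-\gamma}\le1$ (that is, $\gamma\le0$). -/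

import Mathlib

open scoped NNReal

namespace CFMM

/-- An inventory `I > 0`: every asset is held in a strictly positive amount.
Inventories are elements of the closed orthant `ι → ℝ≥0`, where `ι` is the set of assets. -/
def Pos {ι : Type*} (I : ι → ℝ≥0) : Prop :=
  ∀ a, 0 < I a

/-- A trading function: strictly increasing in all variables on strictly positive inventories, and
continuous in the sense that all upper and lower level sets through an inventory are closed. -/
structure IsTradingFunction {ι : Type*} (f : (ι → ℝ≥0) → ℝ) : Prop where
  strictMono : StrictMonoOn f {I | Pos I}
  closed_upper : ∀ J, IsClosed {I | f J ≤ f I}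
  closed_lower : ∀ J, IsClosed {I | f I ≤ f J}

/-- Two functions on inventories are equivalent (for market making) if they have the same
liquidity curves, including on the boundary of the orthant. -/
def Equivalent {ι : Type*} (f g : (ι → ℝ≥0) → ℝ) : Prop :=
  ∀ I J, f I = f J ↔ g I = g J

/-- Independence: for each set `B` of assets and strictly positive inventories `I`, `J`,
`f (I_B, J_{-B}) = f J` if and only if `f I = f (J_B, I_{-B})`.
(`B.piecewise I J` is `I` on `B` and `J` off `B`.) -/
def Independence {ι : Type*} [DecidableEq ι] (f : (ι → ℝ≥0) → ℝ) : Prop :=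
  ∀ (B : Finset ι) (I J : ι → ℝ≥0), Pos I → Pos J →
    (f (B.piecewise I J) = f J ↔ f I = f (B.piecewise J I))

/-- Scale invariance of the liquidity curves. -/
def ScaleInvariance {ι : Type*} (f : (ι → ℝ≥0) → ℝ) : Prop :=
  ∀ (I J : ι → ℝ≥0) (l : ℝ≥0), 0 < l → f I = f J → f (l • I) = f (l • J)

/-- Aversion to permanent loss: the upper level sets are convex. -/
def AversionToPermanentLoss {ι : Type*} (f : (ι → ℝ≥0) → ℝ) : Prop :=
  ∀ J, Convex ℝ≥0 {I | f J ≤ f I}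

/-- Sufficient funds: a liquidity curve through a strictly positive inventory does not meet
the boundary of the orthant. -/
def SufficientFunds {ι : Type*} (f : (ι → ℝ≥0) → ℝ) : Prop :=
  ∀ I J, f I = f J → Pos I → Pos J

open Classical in
/-- The constant inventory elasticity function with parameter `γ`, scale `c` and weights `α`.
For `γ < 0` it takes the value `0` as soon as one of the inventories is zero: this is the usual
reading of the formula, with `0 ^ γ = ∞` and `∞ ^ (1 / γ) = 0`, and the continuous extension of
the function from the strictly positive inventories. -/
noncomputable def cemm {ι : Type*} [Fintype ι] (γ c : ℝ) (α : ι → ℝ) (I : ι → ℝ≥0) : ℝ :=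
  if γ = 0 then c * ∏ a, (I a : ℝ) ^ α a
  else if γ < 0 ∧ ¬ Pos I then 0
  else c * (∑ a, α a * (I a : ℝ) ^ γ) ^ (1 / γ)

/-- `g` is a constant inventory elasticity market maker (CEMM) with parameter `γ`. -/
def IsCEMM {ι : Type*} [Fintype ι] (γ : ℝ) (g : (ι → ℝ≥0) → ℝ) : Prop :=
  ∃ (c : ℝ) (α : ι → ℝ), 0 < c ∧ (∀ a, 0 < α a) ∧ ∑ a, α a = 1 ∧ g = cemm γ c α

/-- The inventory elasticity `1 / (1 - γ)`, for `γ ≠ 1`. (It is infinite for `γ = 1`; the value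
`0` given here to that case is not in the range of elasticities the definition is used for.) -/
noncomputable def elasticity (γ : ℝ) : ℝ :=
  1 / (1 - γ)

/-- The inventory elasticity is positive, the infinite elasticity of `γ = 1` included. -/
def HasPositiveElasticity (γ : ℝ) : Prop :=
  γ ≤ 1

end CFMM

/-! ### Steinhaus' theorem and one-variable calculus of compensation functions -/

namespace CFMM

open Set Filter Topology MeasureTheory

/-! In logarithmic coordinates, independence makes exchange between two assets i, j insensitive to
the other holdings, and scale invariance makes it depend only on the difference of the two
coordinates. So one function of a real variable, `mean w i j`, encodes all trades between i and j.
This function and its complement to the identity are strictly increasing, hence it is 1-Lipschitz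
and almost everywhere differentiable with derivative p in [0, 1]. A third asset ties these functions
together: compensating a change of i in j or in k must be consistent with trading j for k.
Infinitesimally, the odds p / (1 - p) multiply while the arguments add (`hasDerivAt_chain`).

No smoothness is assumed, so the hard point is to exclude the derivatives 0 and 1. If derivative 0
had positive measure for two consecutive pairs, then by Steinhaus it would fill an interval for the
composite pair, against strict monotonicity. Hence derivatives in (0, 1) occur on a set of positive
measure, then (Steinhaus again) on an interval, and, going round a triangle of assets, everywhere
(`IsCompensation.mem_derivSet_Ioo`). The log-odds are measurable and satisfy a Cauchy equation, so
they are affine with a common slope γ (`IsCompensation.exists_logRate_eq`). Integration turns the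
two-asset curves into those of a weighted sum of `util γ`, and two-asset trades join any two points
of equal total utility (`IsPairwiseAdditive.eq_of_totalUtil_eq`). On positive inventories the order
is therefore that of a CEMM.

Closedness of the level sets carries this to the boundary by comparison with the diagonal
(`IsTradingFunction.eq_constPt`). The two remaining axioms only select γ: `convex_cemm` and
`le_one_of_aversion` give γ ≤ 1, `sufficientFunds_cemm_iff` gives γ ≤ 0. -/

/-- **Steinhaus theorem** for two sets: the sum of two sets of reals of positive measure contains
an interval. -/
theorem exists_ball_subset_add {A B : Set ℝ} (hA : MeasurableSet A) (hB : MeasurableSet B)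
    (hA0 : volume A ≠ 0) (hB0 : volume B ≠ 0) :
    ∃ x : ℝ, ∃ ε > 0, ∀ y, |y - x| < ε → ∃ a ∈ A, ∃ b ∈ B, a + b = y := by
  -- By Fubini after a measure-preserving shear, some reflected translate x - B meets A in positive
  -- measure; differences within that intersection then fill a neighbourhood of 0.
  obtain ⟨x, hx⟩ : ∃ x : ℝ, volume (A ∩ (fun a => -a + x) ⁻¹' B) ≠ 0 := by
    by_contra! h
    have hpres := measurePreserving_prod_neg_add (volume : Measure ℝ) (volume : Measure ℝ)
    have h1 := hpres.measure_preimage (hA.prod hB).nullMeasurableSet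
    rw [Measure.prod_prod] at h1
    have hm : MeasurableSet ((fun z : ℝ × ℝ => (z.1, -z.1 + z.2)) ⁻¹' A ×ˢ B) :=
      hpres.measurable (hA.prod hB)
    rw [Measure.prod_apply_symm hm] at h1
    have h2 : ∀ y : ℝ, volume ((fun x => (x, y)) ⁻¹'
        ((fun z : ℝ × ℝ => (z.1, -z.1 + z.2)) ⁻¹' A ×ˢ B)) = 0 := fun y => h y
    simp only [h2, lintegral_zero] at h1
    exact mul_ne_zero hA0 hB0 h1.symm
  set C := A ∩ (fun a => -a + x) ⁻¹' B with hC
  have hCm : MeasurableSet C := hA.inter ((by fun_prop : Measurable fun a : ℝ => -a + x) hB)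
  have hmem := Measure.sub_mem_nhds_zero_of_addHaar_pos volume C hCm (pos_iff_ne_zero.2 hx)
  obtain ⟨ε, hε, hball⟩ := Metric.mem_nhds_iff.1 hmem
  refine ⟨x, ε, hε, fun y hy => ?_⟩
  obtain ⟨a, ha, b, hb, hab⟩ := Set.mem_sub.1 (hball (a := y - x) (by simpa using hy))
  exact ⟨a, ha.1, -b + x, hb.2, by linarith⟩

/-- The function is strictly increasing, with increments smaller than those of the identity. -/
structure SubUnit (φ : ℝ → ℝ) : Prop where
  strictMono : StrictMono φ
  strictMono_sub : StrictMono fun t => t - φ t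

namespace SubUnit

variable {φ : ℝ → ℝ}

theorem lipschitz (h : SubUnit φ) : LipschitzWith 1 φ := by
  refine LipschitzWith.of_le_add fun x y => ?_
  rw [Real.dist_eq]
  rcases le_total x y with hxy | hxy
  · linarith [h.strictMono.monotone hxy, abs_nonneg (x - y)]
  · have := h.strictMono_sub.monotone hxy
    linarith [le_abs_self (x - y)]

theorem continuous (h : SubUnit φ) : Continuous φ := h.lipschitz.continuous

theorem hasDerivAt_nonneg (h : SubUnit φ) {p t : ℝ} (hp : HasDerivAt φ p t) : 0 ≤ p :=
  hp.deriv ▸ h.strictMono.monotone.deriv_nonneg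

theorem hasDerivAt_le_one (h : SubUnit φ) {p t : ℝ} (hp : HasDerivAt φ p t) : p ≤ 1 := by
  have h1 : HasDerivAt (fun t => t - φ t) (1 - p) t := (hasDerivAt_id t).sub hp
  have := h1.deriv ▸ h.strictMono_sub.monotone.deriv_nonneg (x := t)
  linarith

/-- Being Lipschitz rules out Cantor-type behaviour: an absolutely continuous function with
derivative 0 almost everywhere is constant. -/
theorem not_ae_hasDerivAt_zero (h : SubUnit φ) : ¬ ∀ᵐ t, HasDerivAt φ 0 t := by
  intro h0
  have hac : AbsolutelyContinuousOnInterval φ 0 1 :=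
    h.lipschitz.lipschitzOnWith.absolutelyContinuousOnInterval
  obtain ⟨C, hC⟩ := hac.const_of_ae_hasDerivAt_zero (h0.mono fun t ht _ => ht)
  have h1 := hC 0 left_mem_uIcc
  have h2 := hC 1 right_mem_uIcc
  exact absurd (h.strictMono zero_lt_one) (by rw [h1, h2]; exact lt_irrefl _)

theorem not_forall_hasDerivAt_zero (h : SubUnit φ) {x ε : ℝ} (hε : 0 < ε) :
    ¬ ∀ y, |y - x| < ε → HasDerivAt φ 0 y := by
  intro h0
  have hac : AbsolutelyContinuousOnInterval φ x (x + ε / 2) :=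
    h.lipschitz.lipschitzOnWith.absolutelyContinuousOnInterval
  obtain ⟨C, hC⟩ := hac.const_of_ae_hasDerivAt_zero (ae_of_all _ fun t ht => h0 t (by
    rw [uIcc_of_le (by linarith)] at ht
    rw [abs_lt]
    constructor <;> linarith [ht.1, ht.2]))
  have h1 := hC x left_mem_uIcc
  have h2 := hC (x + ε / 2) right_mem_uIcc
  exact absurd (h.strictMono (show x < x + ε / 2 by linarith))
    (by rw [h1, h2]; exact lt_irrefl _)

end SubUnit

theorem exists_small_of_hasDerivAt {φ : ℝ → ℝ} {p t ε : ℝ} (hp : HasDerivAt φ p t) (hε : 0 < ε) :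
    ∃ δ > 0, ∀ σ, |σ| < δ → |φ (t + σ) - φ t - p * σ| ≤ ε * |σ| := by
  have h := (hasDerivAt_iff_isLittleO_nhds_zero.1 hp)
  rw [Asymptotics.isLittleO_iff] at h
  obtain ⟨δ, hδ, h2⟩ := Metric.eventually_nhds_iff.1 (h hε)
  refine ⟨δ, hδ, fun σ hσ => ?_⟩
  have := h2 (y := σ) (by simpa using hσ)
  simpa [mul_comm] using this

/-- The chain rule for compensation functions. -/
theorem hasDerivAt_chain {φ₁ φ₂ φ₃ : ℝ → ℝ} (h₁ : SubUnit φ₁) (h₂ : SubUnit φ₂)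
    (h₃ : SubUnit φ₃)
    (htrans : ∀ s t h k l, φ₁ (t + (h + k)) = φ₁ t + k → φ₃ (s + t + (h + l)) = φ₃ (s + t) + l →
      φ₂ (s + l) - φ₂ (s + -k) = l)
    {p q s t : ℝ} (hp : HasDerivAt φ₁ p t) (hq : HasDerivAt φ₂ q s)
    (hd : 0 < p * q + (1 - p) * (1 - q)) :
    HasDerivAt φ₃ (p * q / (p * q + (1 - p) * (1 - q))) (s + t) := by
  have hp0 := h₁.hasDerivAt_nonneg hp
  have hp1 := h₁.hasDerivAt_le_one hp
  have hq0 := h₂.hasDerivAt_nonneg hq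
  have hq1 := h₂.hasDerivAt_le_one hq
  set d := p * q + (1 - p) * (1 - q) with hd_def
  set D := 1 - p + q with hD_def
  -- `D` vanishes only for p = 1, q = 0, and then `d` vanishes too.
  have hD : 0 < D := by
    rcases hp1.lt_or_eq with h | h
    · simp only [hD_def]; linarith
    · rcases hq0.lt_or_eq with h' | h'
      · simp only [hD_def]; linarith
      · rw [hd_def, h, ← h'] at hd; norm_num at hd
  rw [hasDerivAt_iff_isLittleO_nhds_zero, Asymptotics.isLittleO_iff]
  intro c hc
  -- The bound by `D / 4` absorbs the error terms in |k|; the factor `1 + 8 / D` comes from |τ| +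
  -- 2|k| with |k| ≤ 4|τ| / D.
  obtain ⟨ε, hε, hεD, hεc⟩ : ∃ ε > 0, ε ≤ min 1 (D / 4) ∧ ε * (1 + 8 / D) ≤ c * d := by
    refine ⟨min (min 1 (D / 4)) (c * d / (1 + 8 / D)), by positivity, min_le_left _ _, ?_⟩
    have h8 : 0 < 1 + 8 / D := by positivity
    calc _ ≤ c * d / (1 + 8 / D) * (1 + 8 / D) :=
          mul_le_mul_of_nonneg_right (min_le_right _ _) h8.le
      _ = c * d := by field_simp
  have hε1 : ε ≤ 1 := hεD.trans (min_le_left _ _)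
  have hεD' : ε ≤ D / 4 := hεD.trans (min_le_right _ _)
  obtain ⟨δ₁, hδ₁, hA⟩ := exists_small_of_hasDerivAt hp hε
  obtain ⟨δ₂, hδ₂, hB⟩ := exists_small_of_hasDerivAt hq hε
  set r := s + t with hr
  set δ := min δ₁ δ₂ / 3 with hδ_def
  have hδ : 0 < δ := by positivity
  have hδ1 : 3 * δ ≤ δ₁ := by simp only [hδ_def]; linarith [min_le_left δ₁ δ₂]
  have hδ2 : 3 * δ ≤ δ₂ := by simp only [hδ_def]; linarith [min_le_right δ₁ δ₂]
  have hlim : ∀ κ : ℝ, Tendsto (fun τ => φ₁ (t + (τ - (φ₃ (r + τ) - φ₃ r) + κ)) - κ) (𝓝 0)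
      (𝓝 (φ₁ (t + κ) - κ)) := by
    intro κ
    have hc3 := h₃.continuous
    have hc1 := h₁.continuous
    have : Continuous fun τ => φ₁ (t + (τ - (φ₃ (r + τ) - φ₃ r) + κ)) - κ := by fun_prop
    simpa using this.tendsto 0
  have hup : φ₁ (t + δ) - δ < φ₁ t := by
    have := h₁.strictMono_sub (show t < t + δ by linarith)
    simp only at this; linarith
  have hlo : φ₁ t < φ₁ (t + -δ) - -δ := by
    have := h₁.strictMono_sub (show t + -δ < t by linarith)
    simp only at this; linarith
  filter_upwards [(hlim δ).eventually_lt_const hup, (hlim (-δ)).eventually_const_lt hlo,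
    Metric.ball_mem_nhds 0 hδ] with τ h1 h2 h3
  rw [Metric.mem_ball, dist_zero_right, Real.norm_eq_abs] at h3
  set l := φ₃ (r + τ) - φ₃ r with hl
  set h := τ - l with hh
  -- Both φ₃ and its complement to the identity increase, so `h` and `l` have the sign of τ.
  have habs : |h| + |l| = |τ| := by
    rcases le_total 0 τ with h0 | h0
    · have e1 := h₃.strictMono.monotone (show r ≤ r + τ by linarith)
      have e2 := h₃.strictMono_sub.monotone (show r ≤ r + τ by linarith)
      rw [abs_of_nonneg h0, abs_of_nonneg (by linarith), abs_of_nonneg (by linarith)]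
      linarith
    · have e1 := h₃.strictMono.monotone (show r + τ ≤ r by linarith)
      have e2 := h₃.strictMono_sub.monotone (show r + τ ≤ r by linarith)
      rw [abs_of_nonpos h0, abs_of_nonpos (by linarith), abs_of_nonpos (by linarith)]
      linarith
  -- The compensation of `h` in the middle asset: the strict inequalities at κ = ±δ for τ = 0
  -- persist for small τ, and a value in between does it.
  obtain ⟨k, hk, hk2⟩ : ∃ k ∈ Icc (-δ) δ, φ₁ (t + (h + k)) - k = φ₁ t := by
    have hc : ContinuousOn (fun κ => φ₁ (t + (h + κ)) - κ) (Icc (-δ) δ) := by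
      have := h₁.continuous
      fun_prop
    exact intermediate_value_Icc' (by linarith) hc ⟨h1.le, h2.le⟩
  have hkabs : |k| ≤ δ := abs_le.2 hk
  have hlabs : |l| ≤ |τ| := by linarith [abs_nonneg h]
  have hhabs : |h| ≤ |τ| := by linarith [abs_nonneg l]
  have heq := htrans s t h k l (by linarith) (by rw [hh, ← hr]; ring_nf; rw [hl]; ring)
  have hAk := hA (h + k) (by linarith [abs_add_le h k])
  have hBl := hB l (by linarith)
  have hBk := hB (-k) (by rw [abs_neg]; linarith)
  rw [abs_neg] at hBk
  -- `A` and `B` are the first-order errors of the two compensation equations; eliminating `k`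
  -- between them leaves `d * l - p * q * τ`.
  set A := (1 - p) * k - p * h with hAdef
  set B := (1 - q) * l - q * k with hBdef
  have hA' : |A| ≤ ε * (|h| + |k|) := by
    have e : φ₁ (t + (h + k)) - φ₁ t - p * (h + k) = A := by rw [hAdef]; linarith
    rw [e] at hAk
    exact hAk.trans (mul_le_mul_of_nonneg_left (abs_add_le h k) hε.le)
  have hB' : |B| ≤ ε * (|l| + |k|) := by
    have e : B = (φ₂ (s + l) - φ₂ s - q * l) - (φ₂ (s + -k) - φ₂ s - q * -k) := by
      rw [hBdef]; linarith
    rw [e]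
    calc _ ≤ _ := abs_sub _ _
      _ ≤ ε * |l| + ε * |k| := add_le_add hBl hBk
      _ = _ := by ring
  have hk4 : |k| ≤ 4 * |τ| / D := by
    have e : D * k = A - B + p * h + (1 - q) * l := by rw [hAdef, hBdef, hD_def]; ring
    have e1 : D * |k| ≤ |A| + |B| + |h| + |l| := by
      rw [← abs_of_pos hD, ← abs_mul, e]
      have i1 : |p * h| ≤ |h| := by
        rw [abs_mul, abs_of_nonneg hp0]; exact mul_le_of_le_one_left (abs_nonneg _) hp1
      have i2 : |(1 - q) * l| ≤ |l| := by
        rw [abs_mul, abs_of_nonneg (by linarith)]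
        exact mul_le_of_le_one_left (abs_nonneg _) (by linarith)
      have i3 := abs_add_le (A - B + p * h) ((1 - q) * l)
      have i4 := abs_add_le (A - B) (p * h)
      have i5 := abs_sub A B
      linarith
    rw [le_div_iff₀ hD]
    have e2 : ε * |k| ≤ D / 4 * |k| := mul_le_mul_of_nonneg_right hεD' (abs_nonneg _)
    have e3 : ε * |τ| ≤ 1 * |τ| := mul_le_mul_of_nonneg_right hε1 (abs_nonneg _)
    have e4 : ε * (|h| + |k|) + ε * (|l| + |k|) = ε * |τ| + 2 * (ε * |k|) := by rw [← habs]; ring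
    linarith
  have hfin : |d * l - p * q * τ| ≤ c * d * |τ| := by
    have e : d * l - p * q * τ = (1 - p) * B + q * A := by
      have : τ = h + l := by rw [hh]; ring
      rw [this, hAdef, hBdef, hd_def]; ring
    rw [e]
    have i1 : |(1 - p) * B| ≤ |B| := by
      rw [abs_mul, abs_of_nonneg (by linarith)]
      exact mul_le_of_le_one_left (abs_nonneg _) (by linarith)
    have i2 : |q * A| ≤ |A| := by
      rw [abs_mul, abs_of_nonneg hq0]; exact mul_le_of_le_one_left (abs_nonneg _) hq1
    calc _ ≤ |(1 - p) * B| + |q * A| := abs_add_le _ _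
      _ ≤ ε * (|τ| + 2 * |k|) := by
        rw [← habs]; linarith
      _ ≤ ε * (|τ| + 2 * (4 * |τ| / D)) := by gcongr
      _ = ε * (1 + 8 / D) * |τ| := by field_simp; ring
      _ ≤ c * d * |τ| := by gcongr
  rw [Real.norm_eq_abs, Real.norm_eq_abs, smul_eq_mul]
  have e : l - τ * (p * q / d) = (d * l - p * q * τ) / d := by field_simp
  rw [e, abs_div, abs_of_pos hd, div_le_iff₀ hd]
  linarith

/-! ### Excluding the derivatives 0 and 1 -/

/-- The points where `φ` is differentiable with derivative in `S`. -/
def derivSet (φ : ℝ → ℝ) (S : Set ℝ) : Set ℝ :=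
  {t | ∃ p ∈ S, HasDerivAt φ p t}

theorem measurableSet_derivSet (φ : ℝ → ℝ) {S : Set ℝ} (hS : MeasurableSet S) :
    MeasurableSet (derivSet φ S) := by
  have : derivSet φ S = {t | DifferentiableAt ℝ φ t} ∩ deriv φ ⁻¹' S := by
    ext t
    constructor
    · rintro ⟨p, hp, h⟩
      exact ⟨h.differentiableAt, by rw [mem_preimage, h.deriv]; exact hp⟩
    · rintro ⟨h, hp⟩
      exact ⟨_, hp, h.hasDerivAt⟩
  rw [this]
  exact (measurableSet_of_differentiableAt ℝ φ).inter (measurable_deriv φ hS)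

theorem SubUnit.ae_mem_derivSet {φ : ℝ → ℝ} (h : SubUnit φ) :
    ∀ᵐ t, t ∈ derivSet φ {0} ∨ t ∈ derivSet φ {1} ∨ t ∈ derivSet φ (Ioo 0 1) := by
  filter_upwards [h.lipschitz.ae_differentiableAt_real] with t ht
  have hp := ht.hasDerivAt
  rcases (h.hasDerivAt_nonneg hp).eq_or_lt with h0 | h0
  · exact Or.inl ⟨_, h0.symm, hp⟩
  rcases (h.hasDerivAt_le_one hp).eq_or_lt with h1 | h1
  · exact Or.inr (Or.inl ⟨_, h1, hp⟩)
  · exact Or.inr (Or.inr ⟨_, ⟨h0, h1⟩, hp⟩)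

/-- A family of functions `φ i j` describing trades between the assets `i` and `j`:
in logarithmic coordinates, the amounts `(x, y)` of `i` and `j` are as good as `(m, m)` with
`m = y + φ i j (x - y)`. -/
structure IsCompensation {ι : Type*} (φ : ι → ι → ℝ → ℝ) : Prop where
  strictMono : ∀ {i j}, i ≠ j → StrictMono (φ i j)
  map_zero : ∀ {i j}, i ≠ j → φ i j 0 = 0
  swap : ∀ {i j}, i ≠ j → ∀ t, φ j i t = t + φ i j (-t)
  trans : ∀ {i j k}, i ≠ j → j ≠ k → i ≠ k → ∀ s t h x l,
    φ i j (t + (h + x)) = φ i j t + x → φ i k (s + t + (h + l)) = φ i k (s + t) + l →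
      φ j k (s + l) - φ j k (s + -x) = l

namespace IsCompensation

variable {ι : Type*} {φ : ι → ι → ℝ → ℝ} {i j k : ι}

theorem subUnit (hφ : IsCompensation φ) (hij : i ≠ j) : SubUnit (φ i j) := by
  refine ⟨hφ.strictMono hij, fun s t hst => ?_⟩
  have h1 := hφ.swap hij (-s)
  have h2 := hφ.swap hij (-t)
  have h3 := hφ.strictMono hij.symm (neg_lt_neg hst)
  rw [neg_neg] at h1 h2
  simp only
  linarith

/-- Exchanging the two assets inverts the odds. -/
theorem hasDerivAt_swap (hφ : IsCompensation φ) (hij : i ≠ j) {p t : ℝ}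
    (h : HasDerivAt (φ i j) p t) : HasDerivAt (φ j i) (1 - p) (-t) := by
  have e : φ j i = fun t => t + φ i j (-t) := funext (hφ.swap hij)
  rw [e]
  have h1 : HasDerivAt (φ i j) p (-(-t)) := by rwa [neg_neg]
  have h2 := (hasDerivAt_id (-t)).add (h1.comp (-t) (hasDerivAt_neg (-t)))
  have e2 : 1 + p * -1 = 1 - p := by ring
  exact e2 ▸ h2

theorem hasDerivAt_trans (hφ : IsCompensation φ) (hij : i ≠ j) (hjk : j ≠ k) (hik : i ≠ k)
    {p q s t : ℝ} (hp : HasDerivAt (φ i j) p t) (hq : HasDerivAt (φ j k) q s)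
    (hd : 0 < p * q + (1 - p) * (1 - q)) :
    HasDerivAt (φ i k) (p * q / (p * q + (1 - p) * (1 - q))) (s + t) :=
  hasDerivAt_chain (hφ.subUnit hij) (hφ.subUnit hjk) (hφ.subUnit hik)
    (hφ.trans hij hjk hik) hp hq hd

theorem derivSet_zero_add (hφ : IsCompensation φ) (hij : i ≠ j) (hjk : j ≠ k) (hik : i ≠ k)
    {s t : ℝ} (ht : t ∈ derivSet (φ i j) {0}) (hs : s ∈ derivSet (φ j k) {0}) :
    s + t ∈ derivSet (φ i k) {0} := by
  obtain ⟨p, rfl, hp⟩ := ht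
  obtain ⟨q, rfl, hq⟩ := hs
  exact ⟨_, by simp, hφ.hasDerivAt_trans hij hjk hik hp hq (by norm_num)⟩

theorem derivSet_Ioo_add (hφ : IsCompensation φ) (hij : i ≠ j) (hjk : j ≠ k) (hik : i ≠ k)
    {s t : ℝ} (ht : t ∈ derivSet (φ i j) (Ioo 0 1)) (hs : s ∈ derivSet (φ j k) (Ioo 0 1)) :
    s + t ∈ derivSet (φ i k) (Ioo 0 1) := by
  obtain ⟨p, ⟨hp0, hp1⟩, hp⟩ := ht
  obtain ⟨q, ⟨hq0, hq1⟩, hq⟩ := hs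
  have h1 : 0 < p * q := mul_pos hp0 hq0
  have h2 : 0 < (1 - p) * (1 - q) := mul_pos (by linarith) (by linarith)
  refine ⟨_, ⟨by positivity, ?_⟩, hφ.hasDerivAt_trans hij hjk hik hp hq (by positivity)⟩
  rw [div_lt_one (by positivity)]
  linarith

theorem neg_mem_derivSet_zero_iff (hφ : IsCompensation φ) (hij : i ≠ j) {t : ℝ} :
    -t ∈ derivSet (φ j i) {0} ↔ t ∈ derivSet (φ i j) {1} := by
  constructor
  · rintro ⟨p, rfl, hp⟩
    exact ⟨1, rfl, by simpa using hφ.hasDerivAt_swap hij.symm hp⟩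
  · rintro ⟨p, rfl, hp⟩
    exact ⟨0, rfl, by simpa using hφ.hasDerivAt_swap hij hp⟩

theorem neg_mem_derivSet_Ioo (hφ : IsCompensation φ) (hij : i ≠ j) {t : ℝ}
    (ht : t ∈ derivSet (φ i j) (Ioo 0 1)) : -t ∈ derivSet (φ j i) (Ioo 0 1) := by
  obtain ⟨p, ⟨hp0, hp1⟩, hp⟩ := ht
  exact ⟨1 - p, ⟨by linarith, by linarith⟩, hφ.hasDerivAt_swap hij hp⟩

theorem volume_derivSet_zero_eq (hφ : IsCompensation φ) (hij : i ≠ j) :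
    volume (derivSet (φ j i) {0}) = volume (derivSet (φ i j) {1}) := by
  have e : derivSet (φ i j) {1} = Neg.neg ⁻¹' derivSet (φ j i) {0} := by
    ext t
    exact (hφ.neg_mem_derivSet_zero_iff hij).symm
  rw [e]
  exact (Measure.measure_preimage_neg _ _).symm

/-- Otherwise Steinhaus and `derivSet_zero_add` would give the composite pair derivative 0 on a
whole interval. -/
theorem volume_derivSet_zero (hφ : IsCompensation φ) (hij : i ≠ j) (hjk : j ≠ k) (hik : i ≠ k)
    (h : volume (derivSet (φ i j) {0}) ≠ 0) : volume (derivSet (φ j k) {0}) = 0 := by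
  by_contra h'
  obtain ⟨x, ε, hε, hx⟩ := exists_ball_subset_add
    (measurableSet_derivSet _ (measurableSet_singleton 0))
    (measurableSet_derivSet _ (measurableSet_singleton 0)) h' h
  refine (hφ.subUnit hik).not_forall_hasDerivAt_zero hε (x := x) fun y hy => ?_
  obtain ⟨s, hs, t, ht, rfl⟩ := hx y hy
  obtain ⟨p, rfl, hp⟩ := hφ.derivSet_zero_add hij hjk hik ht hs
  exact hp

theorem ae_mem_derivSet_Ioo (hφ : IsCompensation φ) (hij : i ≠ j)
    (h0 : volume (derivSet (φ i j) {0}) = 0) (h1 : volume (derivSet (φ j i) {0}) = 0) :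
    ∀ᵐ t, t ∈ derivSet (φ i j) (Ioo 0 1) := by
  rw [hφ.volume_derivSet_zero_eq hij] at h1
  filter_upwards [(hφ.subUnit hij).ae_mem_derivSet, measure_eq_zero_iff_ae_notMem.1 h0,
    measure_eq_zero_iff_ae_notMem.1 h1] with t ht h0 h1
  tauto

/-- If the derivative for the pair i, j were almost everywhere 0 or 1, both values would have
positive measure. Then `volume_derivSet_zero` makes the degenerate sets of the pairs through k null,
and composing these pairs yields derivatives in (0, 1) everywhere for i, j. -/
theorem volume_derivSet_Ioo_ne_zero (hφ : IsCompensation φ) (hij : i ≠ j) (hjk : j ≠ k)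
    (hik : i ≠ k) : volume (derivSet (φ i j) (Ioo 0 1)) ≠ 0 := by
  intro h
  have hnot : ∀ {i j : ι}, i ≠ j → volume (derivSet (φ i j) (Ioo 0 1)) = 0 →
      volume (derivSet (φ i j) {1}) = 0 → False := by
    intro i j hij hP hI
    refine (hφ.subUnit hij).not_ae_hasDerivAt_zero ?_
    filter_upwards [(hφ.subUnit hij).ae_mem_derivSet, measure_eq_zero_iff_ae_notMem.1 hP,
      measure_eq_zero_iff_ae_notMem.1 hI] with t ht hP hI
    rcases ht with ⟨p, rfl, hp⟩ | ht | ht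
    · exact hp
    · exact absurd ht hI
    · exact absurd ht hP
  have h' : volume (derivSet (φ j i) (Ioo 0 1)) = 0 := by
    refine measure_mono_null ?_ (((Measure.measure_preimage_neg volume _).trans h))
    intro t ht
    exact hφ.neg_mem_derivSet_Ioo hij.symm ht
  have hZji : volume (derivSet (φ j i) {0}) ≠ 0 := by
    rw [hφ.volume_derivSet_zero_eq hij]
    exact fun h1 => hnot hij h h1
  have hZij : volume (derivSet (φ i j) {0}) ≠ 0 := by
    rw [hφ.volume_derivSet_zero_eq hij.symm]
    exact fun h1 => hnot hij.symm h' h1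
  have hjk0 := hφ.volume_derivSet_zero hij hjk hik hZij
  have hik0 := hφ.volume_derivSet_zero hij.symm hik hjk hZji
  have hki0 : volume (derivSet (φ k i) {0}) = 0 := by
    by_contra h0
    exact hZij (hφ.volume_derivSet_zero hik.symm hij hjk.symm h0)
  have hkj0 : volume (derivSet (φ k j) {0}) = 0 := by
    by_contra h0
    exact hZji (hφ.volume_derivSet_zero hjk.symm hij.symm hik.symm h0)
  have hPik := hφ.ae_mem_derivSet_Ioo hik hik0 hki0
  have hPkj := hφ.ae_mem_derivSet_Ioo hjk.symm hkj0 hjk0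
  have hall : ∀ r : ℝ, r ∈ derivSet (φ i j) (Ioo 0 1) := by
    intro r
    -- Almost every splitting r = (r - t) + t has both parts at good points.
    have h2 : ∀ᵐ t, r - t ∈ derivSet (φ i k) (Ioo 0 1) :=
      (Measure.measurePreserving_sub_left (volume : Measure ℝ) r).quasiMeasurePreserving.ae hPik
    obtain ⟨t, ht1, ht2⟩ := (hPkj.and h2).exists
    have := hφ.derivSet_Ioo_add hik hjk.symm hij ht2 ht1
    simpa using this
  rw [eq_univ_of_forall hall] at h
  simp at h

theorem exists_ball_subset_derivSet_Ioo (hφ : IsCompensation φ) (hij : i ≠ j) (hjk : j ≠ k)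
    (hik : i ≠ k) : ∃ x : ℝ, ∃ ε > 0, ∀ y, |y - x| < ε → y ∈ derivSet (φ i k) (Ioo 0 1) := by
  obtain ⟨x, ε, hε, hx⟩ := exists_ball_subset_add
    (measurableSet_derivSet _ measurableSet_Ioo) (measurableSet_derivSet _ measurableSet_Ioo)
    (hφ.volume_derivSet_Ioo_ne_zero hjk hik.symm hij.symm)
    (hφ.volume_derivSet_Ioo_ne_zero hij hjk hik)
  refine ⟨x, ε, hε, fun y hy => ?_⟩
  obtain ⟨s, hs, t, ht, rfl⟩ := hx y hy
  exact hφ.derivSet_Ioo_add hij hjk hik ht hs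

theorem mem_derivSet_Ioo (hφ : IsCompensation φ) (hij : i ≠ j) (hjk : j ≠ k)
    (hik : i ≠ k) (r : ℝ) : r ∈ derivSet (φ i j) (Ioo 0 1) := by
  obtain ⟨x, ε, hε, hx⟩ := hφ.exists_ball_subset_derivSet_Ioo hij.symm hik hjk
  -- The round trip i → j → k → j shifts the argument by x + u and then by -x, so the good set is
  -- stable under all shifts smaller than ε, hence open and closed.
  have step : ∀ t u : ℝ, |u| < ε → t ∈ derivSet (φ i j) (Ioo 0 1) →
      t + u ∈ derivSet (φ i j) (Ioo 0 1) := by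
    intro t u hu ht
    have h1 := hφ.derivSet_Ioo_add hij hjk hik ht (hx (x + u) (by simpa using hu))
    have h2 := hφ.neg_mem_derivSet_Ioo hjk (hx x (by simpa using hε))
    have h3 := hφ.derivSet_Ioo_add hik hjk.symm hij h1 h2
    convert h3 using 1
    ring
  obtain ⟨t₀, ht₀⟩ : (derivSet (φ i j) (Ioo 0 1)).Nonempty :=
    nonempty_of_measure_ne_zero (hφ.volume_derivSet_Ioo_ne_zero hij hjk hik)
  have hclopen : IsClopen (derivSet (φ i j) (Ioo 0 1)) := by
    constructor
    · rw [← isOpen_compl_iff, Metric.isOpen_iff]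
      refine fun t ht => ⟨ε, hε, fun u hu hu' => ht ?_⟩
      have := step u (t - u) (by rw [abs_sub_comm]; simpa [Real.dist_eq] using hu) hu'
      simpa using this
    · rw [Metric.isOpen_iff]
      refine fun t ht => ⟨ε, hε, fun u hu => ?_⟩
      have := step t (u - t) (by simpa [Real.dist_eq] using hu) ht
      simpa using this
  rw [hclopen.eq_univ ⟨t₀, ht₀⟩]
  trivial

end IsCompensation

/-! ### The Cauchy equation for logarithmic rates -/

theorem exists_linear_of_measurable_additive {L : ℝ → ℝ} (hm : Measurable L)
    (hadd : ∀ s t, L (s + t) = L s + L t) : ∃ γ : ℝ, ∀ t, L t = γ * t := by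
  let f : ℝ →+ ℝ := AddMonoidHom.mk' L hadd
  have hc : Continuous f := MeasureTheory.Measure.AddMonoidHom.continuous_of_measurable f hm
  refine ⟨L 1, fun t => ?_⟩
  have := map_real_smul f hc t 1
  simpa [f, mul_comm] using this

namespace IsCompensation

variable {ι : Type*} {φ : ι → ι → ℝ → ℝ} {i j k : ι}

/-- The logarithm of the marginal rate of substitution. -/
noncomputable def logRate (φ : ι → ι → ℝ → ℝ) (i j : ι) (t : ℝ) : ℝ :=
  Real.log (deriv (φ i j) t / (1 - deriv (φ i j) t))

theorem measurable_logRate : Measurable (logRate φ i j) := by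
  have := measurable_deriv (φ i j)
  unfold logRate
  fun_prop

section

variable (h3 : ∀ i j : ι, ∃ k, k ≠ i ∧ k ≠ j)
include h3

theorem exists_hasDerivAt (hφ : IsCompensation φ) (hij : i ≠ j) (t : ℝ) :
    (0 < deriv (φ i j) t ∧ deriv (φ i j) t < 1) ∧
      HasDerivAt (φ i j) (deriv (φ i j) t) t := by
  obtain ⟨k, hki, hkj⟩ := h3 i j
  obtain ⟨p, hp, h⟩ := hφ.mem_derivSet_Ioo hij hkj.symm hki.symm t
  rw [h.deriv]
  exact ⟨hp, h⟩

theorem logRate_swap (hφ : IsCompensation φ) (hij : i ≠ j) (t : ℝ) :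
    logRate φ j i (-t) = - logRate φ i j t := by
  obtain ⟨-, hp⟩ := hφ.exists_hasDerivAt h3 hij t
  unfold logRate
  rw [(hφ.hasDerivAt_swap hij hp).deriv, ← Real.log_inv, inv_div, sub_sub_cancel]

theorem logRate_trans (hφ : IsCompensation φ) (hij : i ≠ j) (hjk : j ≠ k) (hik : i ≠ k)
    (s t : ℝ) : logRate φ i k (s + t) = logRate φ i j t + logRate φ j k s := by
  obtain ⟨⟨hp0, hp1⟩, hp⟩ := hφ.exists_hasDerivAt h3 hij t
  obtain ⟨⟨hq0, hq1⟩, hq⟩ := hφ.exists_hasDerivAt h3 hjk s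
  unfold logRate
  set p := deriv (φ i j) t
  set q := deriv (φ j k) s
  have hp2 : 0 < 1 - p := by linarith
  have hq2 : 0 < 1 - q := by linarith
  have hd : 0 < p * q + (1 - p) * (1 - q) := by positivity
  rw [(hφ.hasDerivAt_trans hij hjk hik hp hq hd).deriv, ← Real.log_mul (by positivity)
    (by positivity)]
  have e : 1 - p * q / (p * q + (1 - p) * (1 - q))
      = (1 - p) * (1 - q) / (p * q + (1 - p) * (1 - q)) := by
    field_simp; ring
  rw [e]
  congr 1
  field_simp

theorem logRate_eq_affine (hφ : IsCompensation φ) (hij : i ≠ j) :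
    ∃ γ : ℝ, ∀ t, logRate φ i j t = γ * t + logRate φ i j 0 := by
  obtain ⟨k, hki, hkj⟩ := h3 i j
  have htr := fun s t => hφ.logRate_trans h3 hij hkj.symm hki.symm s t
  -- Splitting s + t in several ways through a third asset shows that the rate minus its value at 0
  -- is additive.
  obtain ⟨γ, hγ⟩ := exists_linear_of_measurable_additive
    (L := fun t => logRate φ i j t - logRate φ i j 0) (measurable_logRate.sub_const _) (by
      intro s t
      have h1 := htr 0 (s + t)
      have h2 := htr s t
      have h4 := htr s 0
      have h5 := htr 0 s
      rw [zero_add] at h1 h5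
      rw [add_zero] at h4
      linarith)
  exact ⟨γ, fun t => by linarith [hγ t]⟩

theorem exists_logRate_eq (hφ : IsCompensation φ) :
    ∃ (γ : ℝ) (β : ι → ℝ), ∀ i j, i ≠ j → ∀ t, logRate φ i j t = γ * t + (β i - β j) := by
  rcases isEmpty_or_nonempty ι with hι | ⟨⟨o⟩⟩
  · exact ⟨0, fun _ => 0, fun i => isEmptyElim i⟩
  have haff : ∀ i j, ∃ γ : ℝ, i ≠ j → ∀ t, logRate φ i j t = γ * t + logRate φ i j 0 := by
    intro i j
    by_cases hij : i = j
    · exact ⟨0, fun h => absurd hij h⟩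
    · obtain ⟨γ, hγ⟩ := hφ.logRate_eq_affine h3 hij
      exact ⟨γ, fun _ => hγ⟩
  choose γ hγ using haff
  have hγ1 : ∀ {i j}, i ≠ j → γ i j = logRate φ i j 1 - logRate φ i j 0 := fun hij => by
    linarith [hγ _ _ hij 1]
  have hγ_row : ∀ {i j k}, i ≠ j → i ≠ k → γ i j = γ i k := by
    intro i j k hij hik
    by_cases hjk : j = k
    · rw [hjk]
    have h1 := hφ.logRate_trans h3 hij hjk hik 0 1
    have h2 := hφ.logRate_trans h3 hij hjk hik 0 0
    rw [zero_add] at h1 h2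
    rw [hγ1 hij, hγ1 hik]
    linarith
  have hγ_swap : ∀ {i j}, i ≠ j → γ i j = γ j i := by
    intro i j hij
    have h1 := hφ.logRate_swap h3 hij 1
    have h2 := hφ.logRate_swap h3 hij 0
    rw [neg_zero] at h2
    have h4 := hγ _ _ hij 1
    have h5 := hγ _ _ hij.symm (-1)
    linarith
  obtain ⟨o', ho', -⟩ := h3 o o
  have hγ_const : ∀ {i j}, i ≠ j → γ i j = γ o o' := by
    intro i j hij
    by_cases hio : i = o
    · subst hio; exact hγ_row hij ho'.symm
    · rw [hγ_row hij hio, hγ_swap hio]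
      exact hγ_row (Ne.symm hio) ho'.symm
  classical
  -- The values at 0 form a cocycle, which becomes a difference by measuring every asset against a
  -- base asset `o`.
  refine ⟨γ o o', fun i => if i = o then 0 else logRate φ i o 0, fun i j hij t => ?_⟩
  rw [hγ i j hij t, hγ_const hij]
  congr 1
  beta_reduce
  by_cases hio : i = o
  · have hjo : j ≠ o := fun h => hij (hio.trans h.symm)
    have := hφ.logRate_swap h3 hjo 0
    rw [neg_zero] at this
    rw [if_pos hio, if_neg hjo, hio, this]
    ring
  · by_cases hjo : j = o
    · rw [if_neg hio, if_pos hjo, hjo]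
      ring
    · have := hφ.logRate_trans h3 hij hjo hio 0 0
      rw [zero_add] at this
      rw [if_neg hio, if_neg hjo]
      linarith

theorem exists_weights (hφ : IsCompensation φ) :
    ∃ (γ : ℝ) (α : ι → ℝ), (∀ i, 0 < α i) ∧ ∀ i j, i ≠ j → ∀ t, HasDerivAt (φ i j)
      (α i * Real.exp (γ * t) / (α i * Real.exp (γ * t) + α j)) t := by
  obtain ⟨γ, β, hβ⟩ := hφ.exists_logRate_eq h3
  refine ⟨γ, fun i => Real.exp (β i), fun i => Real.exp_pos _, fun i j hij t => ?_⟩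
  obtain ⟨⟨hp0, hp1⟩, hp⟩ := hφ.exists_hasDerivAt h3 hij t
  have h1 := hβ i j hij t
  unfold logRate at h1
  set p := deriv (φ i j) t
  have hp2 : 0 < 1 - p := by linarith
  have h2 : p / (1 - p) = Real.exp (γ * t) * (Real.exp (β i) / Real.exp (β j)) := by
    rw [← Real.exp_sub, ← Real.exp_add, ← h1, Real.exp_log (by positivity)]
  convert hp using 1
  have hj := Real.exp_pos (β j)
  have hi := Real.exp_pos (β i)
  have hg := Real.exp_pos (γ * t)
  rw [div_eq_iff (by positivity)]
  field_simp at h2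
  linarith

end

end IsCompensation

/-! ### Integrating the rates to an additive utility -/

/-- The utility of an amount `exp x` of one asset, up to a weight and an affine transformation. -/
noncomputable def util (γ x : ℝ) : ℝ :=
  if γ = 0 then x else γ * Real.exp (γ * x)

theorem strictMono_util (γ : ℝ) : StrictMono (util γ) := by
  intro x y hxy
  unfold util
  split_ifs with h
  · exact hxy
  · rcases lt_or_gt_of_ne h with h | h
    · exact mul_lt_mul_of_neg_left (Real.exp_lt_exp.2 (mul_lt_mul_of_neg_left hxy h)) h
    · exact mul_lt_mul_of_pos_left (Real.exp_lt_exp.2 (mul_lt_mul_of_pos_left hxy h)) h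

theorem continuous_util (γ : ℝ) : Continuous (util γ) := by
  unfold util
  split_ifs <;> fun_prop

/-- The differential equation has a conserved quantity: φ minus a linear function for γ = 0, and (a
e^(γt) + b) e^(-γφ(t)) otherwise, whose value at t = 0 is a + b. -/
theorem util_add_util_eq {φ : ℝ → ℝ} {γ a b : ℝ} (ha : 0 < a) (hb : 0 < b) (h0 : φ 0 = 0)
    (hφ : ∀ t, HasDerivAt φ (a * Real.exp (γ * t) / (a * Real.exp (γ * t) + b)) t) (x y : ℝ) :
    a * util γ x + b * util γ y = (a + b) * util γ (y + φ (x - y)) := by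
  by_cases hγ : γ = 0
  · subst hγ
    have h1 : ∀ t, HasDerivAt (fun t => φ t - a / (a + b) * t) 0 t := by
      intro t
      exact ((hφ t).sub ((hasDerivAt_id t).const_mul (a / (a + b)))).congr_deriv (by simp)
    have h2 := is_const_of_deriv_eq_zero (fun t => (h1 t).differentiableAt)
      (fun t => (h1 t).deriv) (x - y) 0
    have h3 : φ (x - y) = a / (a + b) * (x - y) := by
      simp only [h0] at h2
      linarith
    simp only [util, if_true, h3]
    field_simp
    ring
  · have h1 : ∀ t, HasDerivAt
        (fun t => (a * Real.exp (γ * t) + b) * Real.exp (-(γ * φ t))) 0 t := by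
      intro t
      have hE := Real.exp_pos (γ * t)
      have e1 : HasDerivAt (fun t => a * Real.exp (γ * t) + b) (a * (Real.exp (γ * t) * γ)) t := by
        have := ((((hasDerivAt_id t).const_mul γ).exp).const_mul a).add_const b
        simpa using this
      have e2 := (((hφ t).const_mul γ).neg).exp
      refine (e1.mul e2).congr_deriv ?_
      field_simp
      ring
    have h2 := is_const_of_deriv_eq_zero (fun t => (h1 t).differentiableAt)
      (fun t => (h1 t).deriv) (x - y) 0
    simp only [h0, mul_zero, Real.exp_zero, mul_one, neg_zero] at h2
    have e1 : Real.exp (γ * (x - y)) = Real.exp (γ * x) / Real.exp (γ * y) := by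
      rw [mul_sub, Real.exp_sub]
    have e2 : Real.exp (γ * (y + φ (x - y))) = Real.exp (γ * y) * Real.exp (γ * φ (x - y)) := by
      rw [mul_add, Real.exp_add]
    rw [Real.exp_neg, e1] at h2
    simp only [util, if_neg hγ, e2, ← h2]
    have := Real.exp_pos (γ * y)
    have := Real.exp_pos (γ * φ (x - y))
    field_simp

/-! ### Trading functions in logarithmic coordinates -/

section

/-- The point with coordinates `x` and `y` at `i` and `j`, and those of `z` elsewhere. -/
def pair {ι : Type*} [DecidableEq ι] (i j : ι) (x y : ℝ) (z : ι → ℝ) : ι → ℝ :=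
  Function.update (Function.update z i x) j y

/-- A trading function with independence and scale invariance in logarithmic coordinates. -/
structure IsLogTrading {ι : Type*} [DecidableEq ι] (w : (ι → ℝ) → ℝ) : Prop where
  strictMono : StrictMono w
  closed_upper : ∀ y, IsClosed {x | w y ≤ w x}
  closed_lower : ∀ y, IsClosed {x | w x ≤ w y}
  independence : ∀ (B : Finset ι) x y, w (B.piecewise x y) = w y ↔ w x = w (B.piecewise y x)
  translation : ∀ x y s, w x = w y → w (fun a => x a + s) = w (fun a => y a + s)

namespace IsLogTrading

variable {ι : Type*} [DecidableEq ι] {w : (ι → ℝ) → ℝ} {i j k : ι}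

theorem pair_apply {x y : ℝ} {z : ι → ℝ} (m : ι) :
    pair i j x y z m = if m = j then y else if m = i then x else z m := by
  simp [pair, Function.update_apply]

theorem pair_comm (hij : i ≠ j) (x y : ℝ) (z : ι → ℝ) : pair j i x y z = pair i j y x z :=
  Function.update_comm hij.symm _ _ _

theorem pair_self (z : ι → ℝ) : pair i j (z i) (z j) z = z := by
  simp [pair]

/-- This intermediate value property needs no continuity of `w`: a connected interval covered by two
nonempty closed level sets has a point in both. -/
theorem exists_eq (hw : IsLogTrading w) {c : ℝ → ι → ℝ} (hc : Continuous c) {a b : ℝ} (hab : a ≤ b)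
    {y : ι → ℝ} (ha : w (c a) ≤ w y) (hb : w y ≤ w (c b)) : ∃ v ∈ Icc a b, w (c v) = w y := by
  have h := isPreconnected_closed_iff.1 (isPreconnected_Icc (a := a) (b := b)) _ _
    ((hw.closed_lower y).preimage hc) ((hw.closed_upper y).preimage hc)
    (fun v _ => le_total (w (c v)) (w y)) ⟨a, left_mem_Icc.2 hab, ha⟩ ⟨b, right_mem_Icc.2 hab, hb⟩
  obtain ⟨v, hv, h1, h2⟩ := h
  exact ⟨v, hv, le_antisymm h1 h2⟩

theorem pair_lt_pair (hw : IsLogTrading w) (hij : i ≠ j) {x y x' y' : ℝ} (hx : x ≤ x')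
    (hy : y ≤ y') (hxy : x < x' ∨ y < y') (z : ι → ℝ) :
    w (pair i j x y z) < w (pair i j x' y' z) := by
  refine hw.strictMono (Pi.lt_def.2 ⟨fun m => ?_, ?_⟩)
  · rw [pair_apply, pair_apply]
    split_ifs <;> first | assumption | exact le_rfl
  · rcases hxy with h | h
    · exact ⟨i, by simpa [pair_apply, hij] using h⟩
    · exact ⟨j, by simpa [pair_apply] using h⟩

/-- Independence for the set {i, j} exchanges the background `z` for `z'`. -/
theorem pair_congr (hw : IsLogTrading w) {x y x' y' : ℝ} {z : ι → ℝ}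
    (h : w (pair i j x y z) = w (pair i j x' y' z)) (z' : ι → ℝ) :
    w (pair i j x y z') = w (pair i j x' y' z') := by
  have h1 := (hw.independence {i, j} (pair i j x y z') (pair i j x' y' z)).1
  have e1 : ({i, j} : Finset ι).piecewise (pair i j x y z') (pair i j x' y' z)
      = pair i j x y z := by
    funext m
    by_cases hi : m = i <;> by_cases hj : m = j <;>
      simp [Finset.piecewise, pair_apply, hi, hj]
  have e2 : ({i, j} : Finset ι).piecewise (pair i j x' y' z) (pair i j x y z')
      = pair i j x' y' z' := by
    funext m
    by_cases hi : m = i <;> by_cases hj : m = j <;>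
      simp [Finset.piecewise, pair_apply, hi, hj]
  rw [e1, e2] at h1
  exact h1 h

theorem exists_mean (hw : IsLogTrading w) (hij : i ≠ j) (t : ℝ) :
    ∃ v, w (pair i j t 0 0) = w (pair i j v v 0) := by
  have hc : Continuous fun v : ℝ => pair i j v v (0 : ι → ℝ) := by
    refine continuous_pi fun m => ?_
    simp only [pair_apply]
    split_ifs <;> fun_prop
  have key : ∀ {x y x' y' : ℝ}, x ≤ x' → y ≤ y' →
      w (pair i j x y 0) ≤ w (pair i j x' y' 0) := by
    intro x y x' y' hx hy
    rcases hx.eq_or_lt with rfl | hx'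
    · rcases hy.eq_or_lt with rfl | hy'
      · exact le_rfl
      · exact (hw.pair_lt_pair hij hx hy (Or.inr hy') 0).le
    · exact (hw.pair_lt_pair hij hx hy (Or.inl hx') 0).le
  obtain ⟨v, -, hv⟩ := hw.exists_eq hc (a := min t 0) (b := max t 0) (y := pair i j t 0 0)
    min_le_max (key (min_le_left _ _) (min_le_right _ _)) (key (le_max_left _ _) (le_max_right _ _))
  exact ⟨v, hv.symm⟩

open Classical in
/-- The compensation functions of a trading function. -/
noncomputable def mean (w : (ι → ℝ) → ℝ) (i j : ι) (t : ℝ) : ℝ :=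
  if h : ∃ v, w (pair i j t 0 0) = w (pair i j v v 0) then h.choose else 0

theorem pair_eq_mean (hw : IsLogTrading w) (hij : i ≠ j) (x y : ℝ) (z : ι → ℝ) :
    w (pair i j x y z) = w (pair i j (y + mean w i j (x - y)) (y + mean w i j (x - y)) z) := by
  have h0 : w (pair i j (x - y) 0 0)
      = w (pair i j (mean w i j (x - y)) (mean w i j (x - y)) 0) := by
    have h := hw.exists_mean hij (x - y)
    rw [mean, dif_pos h]
    exact h.choose_spec
  have h1 := hw.translation _ _ y h0
  have e : ∀ a b, (fun m => pair i j a b (0 : ι → ℝ) m + y)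
      = pair i j (a + y) (b + y) (fun _ => y) := by
    intro a b
    funext m
    rw [pair_apply, pair_apply]
    split_ifs <;> simp
  rw [e, e, sub_add_cancel, zero_add, add_comm _ y] at h1
  exact hw.pair_congr h1 z

theorem pair_eq_iff (hw : IsLogTrading w) (hij : i ≠ j) {x y x' y' : ℝ} {z : ι → ℝ} :
    w (pair i j x y z) = w (pair i j x' y' z) ↔
      y + mean w i j (x - y) = y' + mean w i j (x' - y') := by
  rw [hw.pair_eq_mean hij x y, hw.pair_eq_mean hij x' y']
  constructor
  · intro h
    by_contra hne
    rcases lt_or_gt_of_ne hne with h' | h'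
    · exact (hw.pair_lt_pair hij h'.le h'.le (Or.inl h') z).ne h
    · exact (hw.pair_lt_pair hij h'.le h'.le (Or.inl h') z).ne h.symm
  · intro h
    rw [h]

theorem pair_diag_le_iff (hw : IsLogTrading w) (hij : i ≠ j) {v v' : ℝ} {z : ι → ℝ} :
    w (pair i j v v z) < w (pair i j v' v' z) ↔ v < v' := by
  constructor
  · intro h
    by_contra! h'
    rcases h'.eq_or_lt with rfl | h'
    · exact lt_irrefl _ h
    · exact lt_asymm h (hw.pair_lt_pair hij h'.le h'.le (Or.inl h') z)
  · exact fun h => hw.pair_lt_pair hij h.le h.le (Or.inl h) z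

theorem isCompensation (hw : IsLogTrading w) : IsCompensation (mean w) where
  strictMono {i j} hij s t hst := by
    have h := hw.pair_lt_pair hij hst.le le_rfl (y := 0) (y' := 0) (Or.inl hst) 0
    rw [hw.pair_eq_mean hij s, hw.pair_eq_mean hij t, hw.pair_diag_le_iff hij] at h
    simpa using h
  map_zero {i j} hij := by
    have h' := hw.pair_diag_le_iff hij (v := 0) (v' := mean w i j 0) (z := 0)
    have h2 := hw.pair_eq_mean hij 0 0 0
    simp only [sub_zero, zero_add] at h2
    rw [h2] at h'
    have h3 := hw.pair_diag_le_iff hij (v := mean w i j 0) (v' := 0) (z := 0)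
    rw [h2] at h3
    simp only [lt_self_iff_false, false_iff, not_lt] at h' h3
    exact le_antisymm h' h3
  swap {i j} hij t := by
    have h1 := hw.pair_eq_mean hij.symm t 0 0
    have h2 := hw.pair_eq_mean hij 0 t 0
    rw [pair_comm hij, pair_comm hij, h2] at h1
    have h3 := hw.pair_diag_le_iff hij (v := t + mean w i j (0 - t))
      (v' := 0 + mean w j i (t - 0)) (z := 0)
    have h4 := hw.pair_diag_le_iff hij (v' := t + mean w i j (0 - t))
      (v := 0 + mean w j i (t - 0)) (z := 0)
    rw [h1] at h3 h4
    simp only [lt_self_iff_false, false_iff, not_lt, zero_add, sub_zero, zero_sub] at h3 h4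
    exact le_antisymm h3 h4
  -- Start from coordinates s + t, s, 0 at i, j, k. A rise of i by `h` is compensated by -x in j or
  -- by -l in k; the two results are equally good and have the same i, so they compare j with k
  -- alone.
  trans {i j k} hij hjk hik s t h x l h1 h2 := by
    have e1 : w (pair i j (s + t + h) (s - x) 0) = w (pair i j (s + t) s 0) := by
      rw [hw.pair_eq_iff hij]
      have a1 : s + t + h - (s - x) = t + (h + x) := by ring
      have a2 : s + t - s = t := by ring
      rw [a1, a2, h1]
      ring
    have e2 : w (pair i k (s + t + h) (-l) (pair i j 0 s 0))
        = w (pair i k (s + t) 0 (pair i j 0 s 0)) := by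
      rw [hw.pair_eq_iff hik]
      have a1 : s + t + h - -l = s + t + (h + l) := by ring
      rw [a1, h2, sub_zero]
      ring
    have b1 : pair i j (s + t + h) (s - x) 0
        = pair j k (s - x) 0 (fun m => if m = i then s + t + h else 0) := by
      funext m
      by_cases hi : m = i <;> by_cases hj : m = j <;> by_cases hk : m = k <;>
        simp_all [pair_apply]
    have b2 : pair i k (s + t + h) (-l) (pair i j 0 s 0)
        = pair j k s (-l) (fun m => if m = i then s + t + h else 0) := by
      funext m
      by_cases hi : m = i <;> by_cases hj : m = j <;> by_cases hk : m = k <;>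
        simp_all [pair_apply]
    have b3 : pair i k (s + t) 0 (pair i j 0 s 0) = pair i j (s + t) s 0 := by
      funext m
      by_cases hi : m = i <;> by_cases hj : m = j <;> by_cases hk : m = k <;>
        simp_all [pair_apply]
    rw [b3, ← e1, b1, b2, hw.pair_eq_iff hjk] at e2
    have a1 : s - -l = s + l := by ring
    have a2 : s - x - 0 = s + -x := by ring
    rw [a1, a2] at e2
    linarith

end IsLogTrading

/-! ### From trades of two assets to all trades -/

/-- Pairwise trades at the rates of an additive utility do not change `w`. -/
structure IsPairwiseAdditive {ι : Type*} [DecidableEq ι] (w : (ι → ℝ) → ℝ) (γ : ℝ) (α : ι → ℝ) :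
    Prop where
  strictMono : StrictMono w
  pos : ∀ i, 0 < α i
  pair_eq : ∀ {i j}, i ≠ j → ∀ {x y x' y' : ℝ},
    α i * util γ x + α j * util γ y = α i * util γ x' + α j * util γ y' →
      ∀ z, w (pair i j x y z) = w (pair i j x' y' z)

/-- The additive utility with weights `α`. -/
noncomputable def totalUtil {ι : Type*} [Fintype ι] (γ : ℝ) (α : ι → ℝ) (x : ι → ℝ) : ℝ :=
  ∑ i, α i * util γ (x i)

variable {ι : Type*} [Fintype ι]

theorem totalUtil_strictMono {γ : ℝ} {α : ι → ℝ} (hα : ∀ i, 0 < α i) :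
    StrictMono (totalUtil γ α) := by
  intro x y hxy
  obtain ⟨hle, i, hi⟩ := Pi.lt_def.1 hxy
  exact Finset.sum_lt_sum
    (fun m _ => mul_le_mul_of_nonneg_left ((strictMono_util γ).monotone (hle m)) (hα m).le)
    ⟨i, Finset.mem_univ i, mul_lt_mul_of_pos_left (strictMono_util γ hi) (hα i)⟩

theorem totalUtil_const (γ : ℝ) (α : ι → ℝ) (v : ℝ) :
    totalUtil γ α (fun _ => v) = (∑ i, α i) * util γ v := by
  rw [totalUtil, Finset.sum_mul]

theorem exists_totalUtil_const_eq {γ : ℝ} {α : ι → ℝ} (hα : ∀ i, 0 < α i) (x : ι → ℝ) :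
    ∃ v, totalUtil γ α (fun _ => v) = totalUtil γ α x := by
  have hM : ∀ i, |x i| ≤ ∑ a, |x a| := fun i =>
    Finset.single_le_sum (f := fun a => |x a|) (fun a _ => abs_nonneg _) (Finset.mem_univ i)
  set M := ∑ a, |x a|
  have hM0 : 0 ≤ M := Finset.sum_nonneg fun a _ => abs_nonneg _
  have hc : Continuous fun v => totalUtil γ α (fun _ => v) := by
    have := continuous_util γ
    simp only [totalUtil_const]
    fun_prop
  obtain ⟨v, -, hv⟩ := intermediate_value_Icc (show -M ≤ M by linarith) hc.continuousOn
    ⟨(totalUtil_strictMono hα).monotone fun i => (abs_le.1 (hM i)).1,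
      (totalUtil_strictMono hα).monotone fun i => (abs_le.1 (hM i)).2⟩
  exact ⟨v, hv⟩

namespace IsPairwiseAdditive

variable [DecidableEq ι] {w : (ι → ℝ) → ℝ} {γ : ℝ} {α : ι → ℝ}

theorem totalUtil_pair {i j : ι} (hij : i ≠ j) (x y x' y' : ℝ) (z : ι → ℝ) :
    totalUtil γ α (pair i j x y z) - totalUtil γ α (pair i j x' y' z)
      = (α i * util γ x + α j * util γ y) - (α i * util γ x' + α j * util γ y') := by
  rw [totalUtil, totalUtil, ← Finset.sum_sub_distrib, Fintype.sum_eq_add i j hij]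
  · simp [IsLogTrading.pair_apply, hij]
    ring
  · rintro m ⟨hi, hj⟩
    simp [IsLogTrading.pair_apply, hi, hj]

/-- Part of the difference between two points is removed by a trade. -/
theorem exists_trade (hw : IsPairwiseAdditive w γ α) {x y : ι → ℝ} {i j : ι} (hi : x i < y i)
    (hj : y j < x j)
    (hle : α i * util γ (y i) - α i * util γ (x i) ≤ α j * util γ (x j) - α j * util γ (y j)) :
    ∃ x', w x' = w x ∧ totalUtil γ α x' = totalUtil γ α x ∧ x' i = y i ∧
      ∀ m, x m = y m → x' m = y m := by
  have hij : i ≠ j := by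
    rintro rfl
    exact lt_asymm hi hj
  have hc : ContinuousOn (fun v => α j * util γ v) (Icc (y j) (x j)) := by
    have := continuous_util γ
    fun_prop
  have hpos := mul_lt_mul_of_pos_left (strictMono_util γ hi) (hw.pos i)
  -- Coordinate i is moved all the way to its target; since its utility gap is the smaller one, j
  -- can pay for it without dropping below `y j`.
  obtain ⟨v, -, hv⟩ := intermediate_value_Icc hj.le hc (show
    α j * util γ (x j) - (α i * util γ (y i) - α i * util γ (x i)) ∈ _ from
      ⟨by linarith, by linarith⟩)
  simp only at hv
  have heq : α i * util γ (y i) + α j * util γ v = α i * util γ (x i) + α j * util γ (x j) := by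
    linarith
  refine ⟨pair i j (y i) v x, ?_, ?_, ?_, fun m hm => ?_⟩
  · rw [hw.pair_eq hij heq, IsLogTrading.pair_self]
  · have := totalUtil_pair (γ := γ) (α := α) hij (y i) v (x i) (x j) x
    rw [IsLogTrading.pair_self] at this
    linarith
  · simp [IsLogTrading.pair_apply, hij]
  · rw [IsLogTrading.pair_apply]
    split_ifs with h1 h2
    · rw [h1] at hm; exact absurd hm hj.ne'
    · rw [h2]
    · exact hm

/-- Two distinct points of equal utility have a coordinate that is too low and one that is too high.
Trading these closes the smaller gap, in `x` or in `y`, and reduces the number of differing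
coordinates. -/
theorem eq_of_totalUtil_eq (hw : IsPairwiseAdditive w γ α) {x y : ι → ℝ}
    (h : totalUtil γ α x = totalUtil γ α y) : w x = w y := by
  induction hn : (Finset.univ.filter fun m => x m ≠ y m).card using Nat.strong_induction_on
    generalizing x y with
  | _ n ih =>
    by_cases hxy : x = y
    · rw [hxy]
    have hex : ∀ {x y : ι → ℝ}, totalUtil γ α x = totalUtil γ α y → x ≠ y → ∃ i, x i < y i := by
      intro x y h hne
      by_contra! hle
      exact (totalUtil_strictMono hw.pos (lt_of_le_of_ne hle hne.symm)).ne h.symm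
    have hcard : ∀ {x y x' y' : ι → ℝ} {i : ι}, x i ≠ y i → x' i = y' i →
        (∀ m, x m = y m → x' m = y' m) → (Finset.univ.filter fun m => x' m ≠ y' m).card
          < (Finset.univ.filter fun m => x m ≠ y m).card := by
      intro x y x' y' i hi hi' hm
      refine Finset.card_lt_card (Finset.ssubset_iff_of_subset ?_ |>.2 ⟨i, ?_, ?_⟩)
      · intro m hm'
        simp only [Finset.mem_filter, Finset.mem_univ, true_and] at hm' ⊢
        exact fun h => hm' (hm m h)
      · simpa using hi
      · simpa using hi'
    obtain ⟨i, hi⟩ := hex h hxy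
    obtain ⟨j, hj⟩ := hex h.symm (Ne.symm hxy)
    rcases le_total (α i * util γ (y i) - α i * util γ (x i))
      (α j * util γ (x j) - α j * util γ (y j)) with hle | hle
    · obtain ⟨x', h1, h2, h3, h4⟩ := hw.exists_trade hi hj hle
      rw [← h1]
      exact ih _ (hn ▸ hcard hi.ne h3 h4) (h2.trans h) rfl
    · obtain ⟨y', h1, h2, h3, h4⟩ := hw.exists_trade hj hi hle
      rw [← h1]
      exact ih _ (hn ▸ hcard hj.ne' h3.symm fun m hm => (h4 m hm.symm).symm) (h.trans h2.symm) rfl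

theorem le_iff_totalUtil_le [Nonempty ι] (hw : IsPairwiseAdditive w γ α) (x y : ι → ℝ) :
    w x ≤ w y ↔ totalUtil γ α x ≤ totalUtil γ α y := by
  -- Both points are moved to the diagonal along their utility levels; there both orders are that of
  -- the real line.
  obtain ⟨v, hv⟩ := exists_totalUtil_const_eq (γ := γ) hw.pos x
  obtain ⟨v', hv'⟩ := exists_totalUtil_const_eq (γ := γ) hw.pos y
  have hconst : StrictMono fun (v : ℝ) (_ : ι) => v := fun a b hab =>
    Pi.lt_def.2 ⟨fun _ => hab.le, Classical.arbitrary ι, hab⟩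
  rw [← hw.eq_of_totalUtil_eq hv, ← hw.eq_of_totalUtil_eq hv', ← hv, ← hv']
  exact ((hw.strictMono.comp hconst).le_iff_le (a := v) (b := v')).trans
    (((totalUtil_strictMono hw.pos).comp hconst).le_iff_le (a := v) (b := v')).symm

end IsPairwiseAdditive

/-- A trading function with independence and scale invariance on at least three assets is, in
logarithmic coordinates, ordinally equivalent to an additive utility. -/
theorem IsLogTrading.exists_totalUtil [DecidableEq ι] {w : (ι → ℝ) → ℝ} (hw : IsLogTrading w)
    (h3 : 2 < Fintype.card ι) :
    ∃ (γ : ℝ) (α : ι → ℝ), (∀ i, 0 < α i) ∧ ∑ i, α i = 1 ∧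
      ∀ x y, w x ≤ w y ↔ totalUtil γ α x ≤ totalUtil γ α y := by
  have hne : Nonempty ι := Fintype.card_pos_iff.1 (by omega)
  have hthird : ∀ i j : ι, ∃ k, k ≠ i ∧ k ≠ j := by
    intro i j
    have hlt : ({i, j} : Finset ι).card < (Finset.univ : Finset ι).card :=
      Finset.card_le_two.trans_lt (by rwa [Finset.card_univ])
    obtain ⟨k, -, hk⟩ := Finset.exists_mem_notMem_of_card_lt_card hlt
    exact ⟨k, by simpa using hk⟩
  have hφ := hw.isCompensation
  obtain ⟨γ, α, hα, hd⟩ := hφ.exists_weights hthird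
  have hpa : IsPairwiseAdditive w γ α := by
    refine ⟨hw.strictMono, hα, fun {i j} hij {x y x' y'} h z => ?_⟩
    rw [hw.pair_eq_iff hij]
    have h1 := util_add_util_eq (hα i) (hα j) (hφ.map_zero hij) (hd i j hij)
    rw [h1, h1] at h
    exact (strictMono_util γ).injective
      (mul_left_cancel₀ (add_pos (hα i) (hα j)).ne' h)
  have hS : 0 < ∑ i, α i := Finset.sum_pos (fun i _ => hα i) Finset.univ_nonempty
  refine ⟨γ, fun i => α i / ∑ a, α a, fun i => div_pos (hα i) hS, ?_, fun x y => ?_⟩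
  · rw [← Finset.sum_div, div_self hS.ne']
  · have e : ∀ x, totalUtil γ (fun i => α i / ∑ a, α a) x = totalUtil γ α x / ∑ a, α a := by
      intro x
      simp only [totalUtil, Finset.sum_div]
      exact Finset.sum_congr rfl fun i _ => by ring
    rw [e, e, div_le_div_iff_of_pos_right hS]
    exact hpa.le_iff_totalUtil_le x y

end

/-! ### CEMMs: continuity, order and axioms -/

section

variable {ι : Type*}

/-- The strictly positive inventory with logarithmic coordinates `x`. -/
noncomputable def expPt (x : ι → ℝ) : ι → ℝ≥0 := fun i => (Real.exp (x i)).toNNReal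

theorem coe_expPt (x : ι → ℝ) (i : ι) : (expPt x i : ℝ) = Real.exp (x i) :=
  Real.coe_toNNReal _ (Real.exp_pos _).le

theorem pos_expPt (x : ι → ℝ) : Pos (expPt x) := fun _ => Real.toNNReal_pos.2 (Real.exp_pos _)

theorem continuous_expPt : Continuous (expPt : (ι → ℝ) → ι → ℝ≥0) :=
  continuous_pi fun i => continuous_real_toNNReal.comp (Real.continuous_exp.comp (continuous_apply i))

theorem expPt_log {I : ι → ℝ≥0} (hI : Pos I) : expPt (fun i => Real.log (I i)) = I := by
  funext i
  refine NNReal.coe_injective ?_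
  rw [coe_expPt, Real.exp_log]
  exact hI i

theorem expPt_piecewise [DecidableEq ι] (B : Finset ι) (x y : ι → ℝ) :
    expPt (B.piecewise x y) = B.piecewise (expPt x) (expPt y) := by
  funext i
  by_cases hi : i ∈ B <;> simp [expPt, hi]

theorem expPt_add (x : ι → ℝ) (s : ℝ) :
    expPt (fun a => x a + s) = (Real.exp s).toNNReal • expPt x := by
  funext i
  rw [Pi.smul_apply, smul_eq_mul, expPt, expPt, Real.exp_add,
    Real.toNNReal_mul (Real.exp_pos _).le, mul_comm]

theorem IsTradingFunction.isLogTrading [DecidableEq ι] {f : (ι → ℝ≥0) → ℝ}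
    (hf : IsTradingFunction f) (hi : Independence f) (hs : ScaleInvariance f) :
    IsLogTrading fun x => f (expPt x) where
  strictMono x y hxy := by
    obtain ⟨hle, i, hlt⟩ := Pi.lt_def.1 hxy
    refine hf.strictMono (pos_expPt x) (pos_expPt y) (Pi.lt_def.2 ⟨fun j => ?_, i, ?_⟩)
    · exact Real.toNNReal_le_toNNReal (Real.exp_le_exp.2 (hle j))
    · exact (Real.toNNReal_lt_toNNReal_iff (Real.exp_pos _)).2 (Real.exp_lt_exp.2 hlt)
  closed_upper y := (hf.closed_upper (expPt y)).preimage continuous_expPt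
  closed_lower y := (hf.closed_lower (expPt y)).preimage continuous_expPt
  independence B x y := by
    rw [expPt_piecewise, expPt_piecewise]
    exact hi B _ _ (pos_expPt x) (pos_expPt y)
  translation x y s h := by
    simp only [expPt_add]
    exact hs _ _ _ (Real.toNNReal_pos.2 (Real.exp_pos s)) h

section cemm

variable [Fintype ι] {γ c : ℝ} {α : ι → ℝ}

theorem cemm_zero (I : ι → ℝ≥0) : cemm 0 c α I = c * ∏ a, (I a : ℝ) ^ α a := by
  simp [cemm]

theorem cemm_of_pos (hγ : 0 < γ) (I : ι → ℝ≥0) :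
    cemm γ c α I = c * (∑ a, α a * (I a : ℝ) ^ γ) ^ (1 / γ) := by
  rw [cemm, if_neg hγ.ne', if_neg fun h => lt_asymm hγ h.1]

theorem cemm_of_neg (hγ : γ < 0) {I : ι → ℝ≥0} (hI : Pos I) :
    cemm γ c α I = c * (∑ a, α a * (I a : ℝ) ^ γ) ^ (1 / γ) := by
  rw [cemm, if_neg hγ.ne, if_neg fun h => h.2 hI]

theorem cemm_of_neg_of_not_pos (hγ : γ < 0) {I : ι → ℝ≥0} (hI : ¬ Pos I) :
    cemm γ c α I = 0 := by
  rw [cemm, if_neg hγ.ne, if_pos ⟨hγ, hI⟩]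

theorem sum_rpow_nonneg (hα : ∀ a, 0 < α a) (I : ι → ℝ≥0) : 0 ≤ ∑ a, α a * (I a : ℝ) ^ γ :=
  Finset.sum_nonneg fun a _ => mul_nonneg (hα a).le (Real.rpow_nonneg (I a).coe_nonneg _)

theorem sum_rpow_pos [Nonempty ι] (hα : ∀ a, 0 < α a) {I : ι → ℝ≥0} (hI : Pos I) :
    0 < ∑ a, α a * (I a : ℝ) ^ γ :=
  Finset.sum_pos (fun a _ => mul_pos (hα a) (Real.rpow_pos_of_pos (hI a) _)) Finset.univ_nonempty

theorem cemm_nonneg (hc : 0 < c) (hα : ∀ a, 0 < α a) (I : ι → ℝ≥0) : 0 ≤ cemm γ c α I := by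
  rcases lt_trichotomy γ 0 with hγ | rfl | hγ
  · by_cases hI : Pos I
    · rw [cemm_of_neg hγ hI]
      exact mul_nonneg hc.le (Real.rpow_nonneg (sum_rpow_nonneg hα I) _)
    · rw [cemm_of_neg_of_not_pos hγ hI]
  · rw [cemm_zero]
    exact mul_nonneg hc.le (Finset.prod_nonneg fun a _ => Real.rpow_nonneg (I a).coe_nonneg _)
  · rw [cemm_of_pos hγ]
    exact mul_nonneg hc.le (Real.rpow_nonneg (sum_rpow_nonneg hα I) _)

theorem cemm_pos [Nonempty ι] (hc : 0 < c) (hα : ∀ a, 0 < α a) {I : ι → ℝ≥0} (hI : Pos I) :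
    0 < cemm γ c α I := by
  have h := mul_pos hc (Real.rpow_pos_of_pos (sum_rpow_pos (γ := γ) hα hI) (1 / γ))
  rcases lt_trichotomy γ 0 with hγ | rfl | hγ
  · rwa [cemm_of_neg hγ hI]
  · rw [cemm_zero]
    exact mul_pos hc (Finset.prod_pos fun a _ => Real.rpow_pos_of_pos (hI a) _)
  · rwa [cemm_of_pos hγ]

theorem cemm_eq_zero (hγ : γ ≤ 0) (hα : ∀ a, 0 < α a) {I : ι → ℝ≥0} (hI : ¬ Pos I) :
    cemm γ c α I = 0 := by
  rcases hγ.lt_or_eq with hγ | rfl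
  · exact cemm_of_neg_of_not_pos hγ hI
  · obtain ⟨a, ha⟩ := not_forall.1 hI
    have ha0 : I a = 0 := le_antisymm (not_lt.1 ha) zero_le
    rw [cemm_zero, Finset.prod_eq_zero (Finset.mem_univ a), mul_zero]
    rw [ha0, NNReal.coe_zero, Real.zero_rpow (hα a).ne']

theorem cemm_const [Nonempty ι] (hα : ∀ a, 0 < α a) (hsum : ∑ a, α a = 1) (s : ℝ≥0) :
    cemm γ c α (fun _ => s) = c * s := by
  have key : γ ≠ 0 → (∑ a, α a * (s : ℝ) ^ γ) ^ (1 / γ) = s := fun h => by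
    rw [← Finset.sum_mul, hsum, one_mul, one_div, Real.rpow_rpow_inv s.coe_nonneg h]
  rcases lt_trichotomy γ 0 with hγ | rfl | hγ
  · by_cases hs : s = 0
    · rw [cemm_of_neg_of_not_pos hγ, hs, NNReal.coe_zero, mul_zero]
      exact fun h => (h (Classical.arbitrary ι)).ne' hs
    · rw [cemm_of_neg hγ fun _ => pos_iff_ne_zero.2 hs, key hγ.ne]
  · rw [cemm_zero, ← Real.rpow_sum_of_nonneg s.coe_nonneg fun a _ => (hα a).le, hsum, Real.rpow_one]
  · rw [cemm_of_pos hγ, key hγ.ne']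

theorem cemm_smul (hα : ∀ a, 0 < α a) (hsum : ∑ a, α a = 1) {l : ℝ≥0} (hl : 0 < l)
    (I : ι → ℝ≥0) : cemm γ c α (l • I) = l * cemm γ c α I := by
  have hpos : Pos (l • I) ↔ Pos I := forall_congr' fun a => by
    rw [Pi.smul_apply, smul_eq_mul, mul_pos_iff_of_pos_left hl]
  have key : γ ≠ 0 → c * (∑ a, α a * ((l • I) a : ℝ) ^ γ) ^ (1 / γ)
      = l * (c * (∑ a, α a * (I a : ℝ) ^ γ) ^ (1 / γ)) := fun h => by
    have e : ∑ a, α a * ((l • I) a : ℝ) ^ γ = (l : ℝ) ^ γ * ∑ a, α a * (I a : ℝ) ^ γ := by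
      rw [Finset.mul_sum]
      refine Finset.sum_congr rfl fun a _ => ?_
      rw [Pi.smul_apply, smul_eq_mul, NNReal.coe_mul, Real.mul_rpow l.coe_nonneg (I a).coe_nonneg]
      ring
    rw [e, Real.mul_rpow (Real.rpow_nonneg l.coe_nonneg _) (sum_rpow_nonneg hα I), one_div,
      Real.rpow_rpow_inv l.coe_nonneg h]
    ring
  rcases lt_trichotomy γ 0 with hγ | rfl | hγ
  · by_cases hI : Pos I
    · rw [cemm_of_neg hγ hI, cemm_of_neg hγ (hpos.2 hI), key hγ.ne]
    · rw [cemm_of_neg_of_not_pos hγ hI, cemm_of_neg_of_not_pos hγ (hpos.not.2 hI), mul_zero]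
  · have e : ∏ a, ((l • I) a : ℝ) ^ α a = l * ∏ a, (I a : ℝ) ^ α a := by
      calc _ = ∏ a, ((l : ℝ) ^ α a * (I a : ℝ) ^ α a) := Finset.prod_congr rfl fun a _ => by
            rw [Pi.smul_apply, smul_eq_mul, NNReal.coe_mul, Real.mul_rpow l.coe_nonneg (I a).coe_nonneg]
        _ = _ := by
            rw [Finset.prod_mul_distrib, ← Real.rpow_sum_of_nonneg l.coe_nonneg fun a _ => (hα a).le, hsum,
              Real.rpow_one]
    rw [cemm_zero, cemm_zero, e]
    ring
  · rw [cemm_of_pos hγ, cemm_of_pos hγ, key hγ.ne']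

theorem isOpen_pos : IsOpen {I : ι → ℝ≥0 | Pos I} := by
  have : {I : ι → ℝ≥0 | Pos I} = ⋂ a, {I | 0 < I a} := by
    ext I
    simp [Pos]
  rw [this]
  exact isOpen_iInter_of_finite fun a => isOpen_lt continuous_const (continuous_apply a)

/-- For γ < 0 the sum exceeds each of its terms and the outer exponent is negative, so a single
coordinate bounds the value; this forces continuity at the boundary. -/
theorem cemm_le_mul (hγ : γ < 0) (hc : 0 < c) (hα : ∀ a, 0 < α a) (I : ι → ℝ≥0) (a : ι) :
    cemm γ c α I ≤ c * (α a ^ (1 / γ) * I a) := by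
  by_cases hI : Pos I
  · have hIa : (0 : ℝ) < I a := hI a
    have h0 : 0 < α a * (I a : ℝ) ^ γ := mul_pos (hα a) (Real.rpow_pos_of_pos hIa _)
    rw [cemm_of_neg hγ hI]
    refine mul_le_mul_of_nonneg_left ?_ hc.le
    calc _ ≤ (α a * (I a : ℝ) ^ γ) ^ (1 / γ) := by
          refine Real.rpow_le_rpow_of_nonpos h0 ?_ (one_div_nonpos.2 hγ.le)
          exact Finset.single_le_sum (f := fun a => α a * (I a : ℝ) ^ γ)
            (fun b _ => mul_nonneg (hα b).le (Real.rpow_nonneg (I b).coe_nonneg _)) (Finset.mem_univ a)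
      _ = α a ^ (1 / γ) * I a := by
          rw [Real.mul_rpow (hα a).le (Real.rpow_nonneg hIa.le _), one_div,
            Real.rpow_rpow_inv hIa.le hγ.ne]
  · rw [cemm_of_neg_of_not_pos hγ hI]
    have := Real.rpow_nonneg (hα a).le (1 / γ)
    positivity

theorem continuous_cemm [Nonempty ι] (hc : 0 < c) (hα : ∀ a, 0 < α a) :
    Continuous (cemm γ c α) := by
  have hcoe : ∀ a, Continuous fun I : ι → ℝ≥0 => (I a : ℝ) := fun a =>
    NNReal.continuous_coe.comp (continuous_apply a)
  rcases lt_trichotomy γ 0 with hγ | rfl | hγ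
  · rw [continuous_iff_continuousAt]
    intro I
    by_cases hI : Pos I
    · have h1 : ContinuousAt (fun I : ι → ℝ≥0 => c * (∑ a, α a * (I a : ℝ) ^ γ) ^ (1 / γ)) I := by
        refine continuousAt_const.mul (ContinuousAt.rpow_const ?_ (Or.inl (sum_rpow_pos hα hI).ne'))
        refine tendsto_finsetSum _ fun a _ => ?_
        exact continuousAt_const.mul ((hcoe a).continuousAt.rpow_const
          (Or.inl (NNReal.coe_pos.2 (hI a)).ne'))
      refine h1.congr ?_
      filter_upwards [isOpen_pos.mem_nhds hI] with J hJ
      exact (cemm_of_neg hγ hJ).symm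
    · obtain ⟨a, ha⟩ := not_forall.1 hI
      have ha0 : I a = 0 := le_antisymm (not_lt.1 ha) zero_le
      rw [ContinuousAt, cemm_of_neg_of_not_pos hγ hI]
      refine squeeze_zero (fun J => cemm_nonneg hc hα J) (fun J => cemm_le_mul hγ hc hα J a) ?_
      have h1 : Continuous fun J : ι → ℝ≥0 => c * (α a ^ (1 / γ) * (J a : ℝ)) :=
        continuous_const.mul (continuous_const.mul (hcoe a))
      simpa [ha0] using h1.tendsto I
  · have e : cemm 0 c α = fun I : ι → ℝ≥0 => c * ∏ a, (I a : ℝ) ^ α a := funext cemm_zero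
    rw [e]
    exact continuous_const.mul (continuous_finsetProd _ fun a _ =>
      (hcoe a).rpow_const fun _ => Or.inr (hα a).le)
  · have e : cemm γ c α = fun I : ι → ℝ≥0 => c * (∑ a, α a * (I a : ℝ) ^ γ) ^ (1 / γ) :=
      funext (cemm_of_pos hγ)
    rw [e]
    exact continuous_const.mul ((continuous_finsetSum _ fun a _ => continuous_const.mul
      ((hcoe a).rpow_const fun _ => Or.inr hγ.le)).rpow_const
        fun _ => Or.inr (one_div_nonneg.2 hγ.le))

theorem cemm_le_cemm_iff_of_pos (hγ : 0 < γ) (hc : 0 < c) (hα : ∀ a, 0 < α a) (I J : ι → ℝ≥0) :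
    cemm γ c α I ≤ cemm γ c α J ↔
      ∑ a, α a * (I a : ℝ) ^ γ ≤ ∑ a, α a * (J a : ℝ) ^ γ := by
  rw [cemm_of_pos hγ, cemm_of_pos hγ, mul_le_mul_iff_right₀ hc,
    Real.rpow_le_rpow_iff (sum_rpow_nonneg hα I) (sum_rpow_nonneg hα J) (one_div_pos.2 hγ)]

theorem cemm_le_cemm_iff_of_neg [Nonempty ι] (hγ : γ < 0) (hc : 0 < c) (hα : ∀ a, 0 < α a)
    {I J : ι → ℝ≥0} (hI : Pos I) (hJ : Pos J) :
    cemm γ c α I ≤ cemm γ c α J ↔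
      ∑ a, α a * (J a : ℝ) ^ γ ≤ ∑ a, α a * (I a : ℝ) ^ γ := by
  rw [cemm_of_neg hγ hI, cemm_of_neg hγ hJ, mul_le_mul_iff_right₀ hc,
    Real.rpow_le_rpow_iff_of_neg (sum_rpow_pos hα hI) (sum_rpow_pos hα hJ)
      (one_div_neg.2 hγ)]

theorem cemm_expPt_le_iff [Nonempty ι] (hc : 0 < c) (hα : ∀ a, 0 < α a) (x y : ι → ℝ) :
    cemm γ c α (expPt x) ≤ cemm γ c α (expPt y) ↔ totalUtil γ α x ≤ totalUtil γ α y := by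
  have e : ∀ z : ι → ℝ, γ ≠ 0 →
      totalUtil γ α z = γ * ∑ a, α a * (expPt z a : ℝ) ^ γ := by
    intro z hγ
    rw [totalUtil, Finset.mul_sum]
    refine Finset.sum_congr rfl fun a _ => ?_
    rw [util, if_neg hγ, coe_expPt, ← Real.exp_mul, mul_comm (z a)]
    ring
  rcases lt_trichotomy γ 0 with hγ | rfl | hγ
  · rw [cemm_le_cemm_iff_of_neg hγ hc hα (pos_expPt x) (pos_expPt y), e x hγ.ne, e y hγ.ne,
      mul_le_mul_left_of_neg hγ]
  · have e0 : ∀ z : ι → ℝ, cemm 0 c α (expPt z) = c * Real.exp (totalUtil 0 α z) := by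
      intro z
      rw [cemm_zero, totalUtil, Real.exp_sum]
      congr 1
      refine Finset.prod_congr rfl fun a _ => ?_
      rw [util, if_pos rfl, coe_expPt, ← Real.exp_mul, mul_comm]
    rw [e0, e0, mul_le_mul_iff_right₀ hc, Real.exp_le_exp]
  · rw [cemm_le_cemm_iff_of_pos hγ hc hα, e x hγ.ne', e y hγ.ne', mul_le_mul_iff_right₀ hγ]

theorem cemm_eq_iff [Nonempty ι] (hc : 0 < c) (hα : ∀ a, 0 < α a) {I J : ι → ℝ≥0} (hI : Pos I)
    (hJ : Pos J) : cemm γ c α I = cemm γ c α J ↔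
      totalUtil γ α (fun a => Real.log (I a)) = totalUtil γ α (fun a => Real.log (J a)) := by
  have h1 := cemm_expPt_le_iff (γ := γ) hc hα (fun a => Real.log (I a)) (fun a => Real.log (J a))
  have h2 := cemm_expPt_le_iff (γ := γ) hc hα (fun a => Real.log (J a)) (fun a => Real.log (I a))
  rw [expPt_log hI, expPt_log hJ] at h1 h2
  rw [le_antisymm_iff, h1, h2, le_antisymm_iff]

theorem independence_cemm [Nonempty ι] [DecidableEq ι] (hc : 0 < c) (hα : ∀ a, 0 < α a) :
    Independence (cemm γ c α) := by
  intro B I J hI hJ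
  have hpw : ∀ {I J : ι → ℝ≥0}, Pos I → Pos J → Pos (B.piecewise I J) := by
    intro I J hI hJ a
    by_cases ha : a ∈ B
    · simpa [ha] using hI a
    · simpa [ha] using hJ a
  rw [cemm_eq_iff hc hα (hpw hI hJ) hJ, cemm_eq_iff hc hα hI (hpw hJ hI)]
  -- The two mixtures together hold, coordinate by coordinate, what `I` and `J` hold together.
  have e : totalUtil γ α (fun a => Real.log (B.piecewise I J a))
      + totalUtil γ α (fun a => Real.log (B.piecewise J I a))
      = totalUtil γ α (fun a => Real.log (I a)) + totalUtil γ α (fun a => Real.log (J a)) := by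
    simp only [totalUtil, ← Finset.sum_add_distrib]
    refine Finset.sum_congr rfl fun a _ => ?_
    by_cases ha : a ∈ B <;> simp [ha, add_comm]
  constructor <;> intro h <;> linarith

/-- Convexity of a negative power from two uses of the weighted AM-GM inequality, before and after
raising to γ. -/
theorem rpow_smul_add_smul_le {x y a b : ℝ} (hγ : γ < 0) (hx : 0 < x) (hy : 0 < y) (ha : 0 ≤ a)
    (hb : 0 ≤ b) (hab : a + b = 1) : (a * x + b * y) ^ γ ≤ a * x ^ γ + b * y ^ γ := by
  have hx' := Real.rpow_pos_of_pos hx a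
  have hy' := Real.rpow_pos_of_pos hy b
  calc (a * x + b * y) ^ γ ≤ (x ^ a * y ^ b) ^ γ :=
        Real.rpow_le_rpow_of_nonpos (mul_pos hx' hy')
          (Real.geom_mean_le_arith_mean2_weighted ha hb hx.le hy.le hab) hγ.le
    _ = (x ^ γ) ^ a * (y ^ γ) ^ b := by
        rw [Real.mul_rpow hx'.le hy'.le, ← Real.rpow_mul hx.le, ← Real.rpow_mul hy.le,
          ← Real.rpow_mul hx.le, ← Real.rpow_mul hy.le, mul_comm a, mul_comm b]
    _ ≤ a * x ^ γ + b * y ^ γ := Real.geom_mean_le_arith_mean2_weighted ha hb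
        (Real.rpow_nonneg hx.le _) (Real.rpow_nonneg hy.le _) hab

/-- For γ < 0 the upper level sets through positive inventories are sublevel sets of a convex sum;
for γ = 0 weighted AM-GM in each factor suffices; for 0 < γ ≤ 1 the sum is concave. -/
theorem convex_cemm [Nonempty ι] (hγ1 : γ ≤ 1) (hc : 0 < c) (hα : ∀ a, 0 < α a) :
    AversionToPermanentLoss (cemm γ c α) := by
  intro K I hI J hJ a b _ _ hab
  have hab' : (a : ℝ) + b = 1 := by exact_mod_cast hab
  have hcoe : ∀ m, ((a • I + b • J) m : ℝ) = a * I m + b * J m := fun m => by simp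
  rw [mem_ofPred_eq] at hI hJ ⊢
  rcases lt_trichotomy γ 0 with hγ | rfl | hγ
  · by_cases hK : Pos K
    · have hpos : ∀ {I}, cemm γ c α K ≤ cemm γ c α I → Pos I := by
        intro I hI
        by_contra h
        rw [cemm_of_neg_of_not_pos hγ h] at hI
        exact (cemm_pos hc hα hK).not_ge hI
      have hIp := hpos hI
      have hJp := hpos hJ
      have hp : Pos (a • I + b • J) := fun m => by
        rw [Pi.add_apply, Pi.smul_apply, Pi.smul_apply, smul_eq_mul, smul_eq_mul]
        rcases eq_or_ne a 0 with rfl | ha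
        · rw [zero_add] at hab
          simpa [hab] using hJp m
        · exact add_pos_of_pos_of_nonneg (mul_pos (pos_iff_ne_zero.2 ha) (hIp m)) zero_le
      rw [cemm_le_cemm_iff_of_neg hγ hc hα hK hIp] at hI
      rw [cemm_le_cemm_iff_of_neg hγ hc hα hK hJp] at hJ
      rw [cemm_le_cemm_iff_of_neg hγ hc hα hK hp]
      calc _ ≤ ∑ m, (a * (α m * (I m : ℝ) ^ γ) + b * (α m * (J m : ℝ) ^ γ)) := by
            refine Finset.sum_le_sum fun m _ => ?_
            have := mul_le_mul_of_nonneg_left (rpow_smul_add_smul_le hγ (x := I m) (y := J m)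
              (hIp m) (hJp m) a.coe_nonneg b.coe_nonneg hab') (hα m).le
            rw [hcoe]
            refine this.trans (le_of_eq ?_)
            ring
        _ = a * ∑ m, α m * (I m : ℝ) ^ γ + b * ∑ m, α m * (J m : ℝ) ^ γ := by
            rw [Finset.sum_add_distrib, Finset.mul_sum, Finset.mul_sum]
        _ ≤ a * ∑ m, α m * (K m : ℝ) ^ γ + b * ∑ m, α m * (K m : ℝ) ^ γ := by gcongr
        _ = _ := by rw [← add_mul, hab', one_mul]
    · rw [cemm_of_neg_of_not_pos hγ hK]
      exact cemm_nonneg hc hα _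
  · rw [cemm_zero, cemm_zero, mul_le_mul_iff_right₀ hc] at hI hJ ⊢
    have hn : ∀ {I : ι → ℝ≥0}, 0 ≤ ∏ m, (I m : ℝ) ^ α m := fun {I} =>
      Finset.prod_nonneg fun m _ => Real.rpow_nonneg (I m).coe_nonneg _
    have hprod : ∀ (I : ι → ℝ≥0) (a : ℝ≥0),
        (∏ m, (I m : ℝ) ^ α m) ^ (a : ℝ) = ∏ m, ((I m : ℝ) ^ (a : ℝ)) ^ α m := by
      intro I a
      rw [← Real.finsetProd_rpow _ _ fun m _ => Real.rpow_nonneg (I m).coe_nonneg _]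
      refine Finset.prod_congr rfl fun m _ => ?_
      rw [← Real.rpow_mul (I m).coe_nonneg, ← Real.rpow_mul (I m).coe_nonneg, mul_comm]
    calc _ = (∏ m, (K m : ℝ) ^ α m) ^ (a : ℝ) * (∏ m, (K m : ℝ) ^ α m) ^ (b : ℝ) := by
          rw [← Real.rpow_add_of_nonneg hn a.coe_nonneg b.coe_nonneg, hab', Real.rpow_one]
      _ ≤ (∏ m, (I m : ℝ) ^ α m) ^ (a : ℝ) * (∏ m, (J m : ℝ) ^ α m) ^ (b : ℝ) := by
          gcongr
      _ = ∏ m, ((I m : ℝ) ^ (a : ℝ) * (J m : ℝ) ^ (b : ℝ)) ^ α m := by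
          rw [hprod, hprod, ← Finset.prod_mul_distrib]
          refine Finset.prod_congr rfl fun m _ => ?_
          rw [Real.mul_rpow (Real.rpow_nonneg (I m).coe_nonneg _) (Real.rpow_nonneg (J m).coe_nonneg _)]
      _ ≤ _ := by
          refine Finset.prod_le_prod (fun m _ => by positivity) fun m _ => ?_
          rw [hcoe]
          exact Real.rpow_le_rpow (by positivity)
            (Real.geom_mean_le_arith_mean2_weighted a.coe_nonneg b.coe_nonneg (I m).coe_nonneg (J m).coe_nonneg hab') (hα m).le
  · rw [cemm_le_cemm_iff_of_pos hγ hc hα] at hI hJ ⊢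
    calc _ = a * ∑ m, α m * (K m : ℝ) ^ γ + b * ∑ m, α m * (K m : ℝ) ^ γ := by
          rw [← add_mul, hab', one_mul]
      _ ≤ a * ∑ m, α m * (I m : ℝ) ^ γ + b * ∑ m, α m * (J m : ℝ) ^ γ := by gcongr
      _ = ∑ m, (a * (α m * (I m : ℝ) ^ γ) + b * (α m * (J m : ℝ) ^ γ)) := by
          rw [Finset.sum_add_distrib, Finset.mul_sum, Finset.mul_sum]
      _ ≤ _ := by
          refine Finset.sum_le_sum fun m _ => ?_
          have h1 := (Real.concaveOn_rpow hγ.le hγ1).2 (x := (I m : ℝ)) (I m).coe_nonneg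
            (y := (J m : ℝ)) (J m).coe_nonneg a.coe_nonneg b.coe_nonneg hab'
          have h2 := mul_le_mul_of_nonneg_left h1 (hα m).le
          rw [hcoe]
          refine le_trans (le_of_eq ?_) h2
          simp only [smul_eq_mul]
          ring

variable [DecidableEq ι]

/-- For `γ > 0` an inventory of a single asset can be as good as one unit of each. -/
theorem sum_single_rpow (hγ : 0 < γ) (hα : ∀ a, 0 < α a) (i : ι) :
    ∑ a, α a * ((Pi.single i (α i ^ (-(1 / γ))).toNNReal : ι → ℝ≥0) a : ℝ) ^ γ = 1 := by
  rw [Finset.sum_eq_single i]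
  · rw [Pi.single_eq_same, Real.coe_toNNReal _ (Real.rpow_nonneg (hα i).le _),
      ← Real.rpow_mul (hα i).le]
    have : -(1 / γ) * γ = -1 := by field_simp
    rw [this, Real.rpow_neg_one, mul_inv_cancel₀ (hα i).ne']
  · intro b _ hb
    rw [Pi.single_eq_of_ne hb, NNReal.coe_zero, Real.zero_rpow hγ.ne', mul_zero]
  · exact fun h => absurd (Finset.mem_univ i) h

theorem cemm_single (hγ : 0 < γ) (hα : ∀ a, 0 < α a) (i : ι) :
    cemm γ c α (Pi.single i (α i ^ (-(1 / γ))).toNNReal) = c := by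
  rw [cemm_of_pos hγ, sum_single_rpow hγ hα, Real.one_rpow, mul_one]

/-- Take two equally good inventories of one asset each: at their midpoint the sum is 2 · (1/2)^γ,
which falls below the common level 1 when γ > 1. -/
theorem le_one_of_aversion [Nontrivial ι] (hc : 0 < c) (hα : ∀ a, 0 < α a)
    (h : AversionToPermanentLoss (cemm γ c α)) : γ ≤ 1 := by
  by_contra! hγ1
  have hγ : 0 < γ := by linarith
  obtain ⟨i, j, hij⟩ := exists_pair_ne ι
  set I : ι → ℝ≥0 := Pi.single i (α i ^ (-(1 / γ))).toNNReal with hI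
  set J : ι → ℝ≥0 := Pi.single j (α j ^ (-(1 / γ))).toNNReal with hJ
  have hIc : cemm γ c α I = c := cemm_single hγ hα i
  have hJc : cemm γ c α J = c := cemm_single hγ hα j
  have hmid := h I (x := I) (by rw [mem_ofPred_eq]) (y := J) (by rw [mem_ofPred_eq, hIc, hJc])
    (a := 1 / 2) (b := 1 / 2) zero_le zero_le (add_halves 1)
  rw [mem_ofPred_eq, cemm_le_cemm_iff_of_pos hγ hc hα] at hmid
  have e : ∑ a, α a * (((1 / 2 : ℝ≥0) • I + (1 / 2 : ℝ≥0) • J) a : ℝ) ^ γ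
      = (1 / 2) ^ γ * (∑ a, α a * (I a : ℝ) ^ γ + ∑ a, α a * (J a : ℝ) ^ γ) := by
    rw [← Finset.sum_add_distrib, Finset.mul_sum]
    refine Finset.sum_congr rfl fun a _ => ?_
    have h0 : I a = 0 ∨ J a = 0 := by
      by_cases ha : a = i
      · exact Or.inr (by rw [hJ, Pi.single_eq_of_ne (ha ▸ hij)])
      · exact Or.inl (by rw [hI, Pi.single_eq_of_ne ha])
    rw [Pi.add_apply, Pi.smul_apply, Pi.smul_apply, smul_eq_mul, smul_eq_mul]
    push_cast
    rcases h0 with h0 | h0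
    · rw [h0, NNReal.coe_zero, Real.zero_rpow hγ.ne', mul_zero, zero_add, mul_zero, zero_add,
        Real.mul_rpow (by norm_num) (J a).coe_nonneg]
      ring
    · rw [h0, NNReal.coe_zero, Real.zero_rpow hγ.ne', mul_zero, add_zero, mul_zero, add_zero,
        Real.mul_rpow (by norm_num) (I a).coe_nonneg]
      ring
  rw [e, sum_single_rpow hγ hα, sum_single_rpow hγ hα] at hmid
  have hlt : (1 / 2 : ℝ) ^ γ < (1 / 2 : ℝ) ^ (1 : ℝ) :=
    Real.rpow_lt_rpow_of_exponent_gt (by norm_num) (by norm_num) hγ1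
  rw [Real.rpow_one] at hlt
  linarith

theorem sufficientFunds_cemm_iff [Nontrivial ι] (hc : 0 < c) (hα : ∀ a, 0 < α a)
    (hsum : ∑ a, α a = 1) : SufficientFunds (cemm γ c α) ↔ γ ≤ 0 := by
  constructor
  · intro h
    by_contra! hγ
    obtain ⟨i, j, hij⟩ := exists_pair_ne ι
    have h1 := h (fun _ => 1) (Pi.single i (α i ^ (-(1 / γ))).toNNReal)
      (by rw [cemm_const hα hsum, cemm_single hγ hα, NNReal.coe_one, mul_one])
      (fun _ => one_pos) j
    rw [Pi.single_eq_of_ne hij.symm] at h1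
    exact lt_irrefl _ h1
  · intro hγ I J hIJ hI
    by_contra hJ
    have := cemm_pos (γ := γ) hc hα hI
    rw [hIJ, cemm_eq_zero hγ hα hJ] at this
    exact lt_irrefl _ this

end cemm

end

/-! ### Boundary inventories and transfer along equivalence -/

section

section

variable {ι : Type*}

/-- The inventory with the amount `s` of each asset. -/
def constPt (ι : Type*) (s : ℝ≥0) : ι → ℝ≥0 := fun _ => s

theorem continuous_constPt : Continuous (constPt ι) := continuous_pi fun _ => continuous_id

theorem tendsto_add_constPt (I : ι → ℝ≥0) :
    Tendsto (fun ε : ℝ≥0 => I + constPt ι ε) (𝓝[>] 0) (𝓝 I) := by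
  have h : Continuous fun ε : ℝ≥0 => I + constPt ι ε := continuous_const.add continuous_constPt
  have h0 := h.tendsto 0
  rw [show I + constPt ι 0 = I from add_zero I] at h0
  exact h0.mono_left nhdsWithin_le_nhds

theorem eventually_pos_add_constPt (I : ι → ℝ≥0) :
    ∀ᶠ ε : ℝ≥0 in 𝓝[>] 0, Pos (I + constPt ι ε) := by
  filter_upwards [self_mem_nhdsWithin] with ε hε a
  exact add_pos_of_nonneg_of_pos zero_le hε

theorem tendsto_constPt_right (t : ℝ≥0) : Tendsto (constPt ι) (𝓝[>] t) (𝓝 (constPt ι t)) :=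
  (continuous_constPt.tendsto t).mono_left nhdsWithin_le_nhds

theorem tendsto_constPt_left (t : ℝ≥0) : Tendsto (constPt ι) (𝓝[<] t) (𝓝 (constPt ι t)) :=
  (continuous_constPt.tendsto t).mono_left nhdsWithin_le_nhds

variable {f : (ι → ℝ≥0) → ℝ}

theorem IsTradingFunction.constPt_lt [Nonempty ι] (hf : IsTradingFunction f) {s t : ℝ≥0}
    (hs : 0 < s) (hst : s < t) : f (constPt ι s) < f (constPt ι t) :=
  hf.strictMono (fun _ => hs) (fun _ => hs.trans hst)
    (Pi.lt_def.2 ⟨fun _ => hst.le, Classical.arbitrary ι, hst⟩)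

theorem IsTradingFunction.strictMono_constPt [Nonempty ι] (hf : IsTradingFunction f) :
    StrictMono fun s => f (constPt ι s) := by
  intro s t hst
  rcases (zero_le (a := s)).eq_or_lt with rfl | hs
  · have ht2 : 0 < t / 2 := half_pos hst
    have h1 : f (constPt ι 0) ≤ f (constPt ι (t / 2)) := by
      refine (hf.closed_lower (constPt ι (t / 2))).mem_of_tendsto (tendsto_constPt_right 0) ?_
      filter_upwards [Ioo_mem_nhdsGT ht2] with s hs
      exact (hf.constPt_lt hs.1 hs.2).le
    exact h1.trans_lt (hf.constPt_lt ht2 (half_lt_self hst))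
  · exact hf.constPt_lt hs hst

variable {g : (ι → ℝ≥0) → ℝ} {c : ℝ}

/-- A trading function that orders the strictly positive inventories as a continuous homogeneous
function does takes the same values as on the diagonal. -/
theorem IsTradingFunction.eq_constPt [Finite ι] [Nonempty ι] (hf : IsTradingFunction f)
    (hc : 0 < c) (hg : Continuous g) (hg0 : ∀ I, 0 ≤ g I) (hgc : ∀ s, g (constPt ι s) = c * s)
    (hfg : ∀ I J, Pos I → Pos J → (f I ≤ f J ↔ g I ≤ g J)) (I : ι → ℝ≥0) :
    f I = f (constPt ι (g I / c).toNNReal) := by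
  set t := (g I / c).toNNReal with ht
  have hgI : g I = c * t := by
    rw [ht, Real.coe_toNNReal _ (div_nonneg (hg0 I) hc.le)]
    field_simp
  have hlim := (hg.tendsto I).comp (tendsto_add_constPt I)
  -- Approach `I` by the positive inventories `I + constPt ι ε`, where `f` and `g` order alike, and
  -- use that level sets of `f` are closed.
  have hup : ∀ s, t < s → f I ≤ f (constPt ι s) := by
    intro s hs
    refine (hf.closed_lower (constPt ι s)).mem_of_tendsto (tendsto_add_constPt I) ?_
    have hlt : g I < c * s := by
      rw [hgI]
      exact mul_lt_mul_of_pos_left (NNReal.coe_lt_coe.2 hs) hc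
    filter_upwards [hlim.eventually_lt_const hlt, eventually_pos_add_constPt I] with ε h1 h2
    refine (hfg _ (constPt ι s) h2 fun _ => zero_le.trans_lt hs).2 ?_
    rw [hgc]
    exact h1.le
  have hlo : ∀ s, 0 < s → s < t → f (constPt ι s) ≤ f I := by
    intro s hs0 hs
    refine (hf.closed_upper (constPt ι s)).mem_of_tendsto (tendsto_add_constPt I) ?_
    have hlt : c * s < g I := by
      rw [hgI]
      exact mul_lt_mul_of_pos_left (NNReal.coe_lt_coe.2 hs) hc
    filter_upwards [hlim.eventually_const_lt hlt, eventually_pos_add_constPt I] with ε h1 h2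
    refine (hfg (constPt ι s) _ (fun _ => hs0) h2).2 ?_
    rw [hgc]
    exact h1.le
  refine le_antisymm ?_ ?_
  · refine (hf.closed_upper I).mem_of_tendsto (tendsto_constPt_right t) ?_
    filter_upwards [self_mem_nhdsWithin] with s hs
    exact hup s hs
  -- For t = 0 no diagonal point lies below; instead small constants lie under `I + constPt ι ε`,
  -- and two limits give the inequality.
  · rcases (zero_le (a := t)).eq_or_lt with h0 | h0
    · rw [← h0]
      refine (hf.closed_upper (constPt ι 0)).mem_of_tendsto (tendsto_add_constPt I) ?_
      filter_upwards [eventually_pos_add_constPt I] with ε hK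
      refine (hf.closed_lower _).mem_of_tendsto (tendsto_constPt_right 0) ?_
      have hev : ∀ᶠ s : ℝ≥0 in 𝓝[>] 0, ∀ a, s < (I + constPt ι ε) a :=
        eventually_all.2 fun a => nhdsWithin_le_nhds (Iio_mem_nhds (hK a))
      filter_upwards [hev, self_mem_nhdsWithin] with s hs hs0
      exact hf.strictMono.monotoneOn (fun _ => hs0) hK fun a => (hs a).le
    · have : (𝓝[<] t).NeBot := nhdsLT_neBot_of_exists_lt ⟨0, h0⟩
      refine (hf.closed_lower I).mem_of_tendsto (tendsto_constPt_left t) ?_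
      filter_upwards [Ioo_mem_nhdsLT h0] with s hs
      exact hlo s hs.1 hs.2

theorem IsTradingFunction.le_iff [Nonempty ι] (hf : IsTradingFunction f)
    (hc : 0 < c) (hg0 : ∀ I, 0 ≤ g I)
    (hrep : ∀ I, f I = f (constPt ι (g I / c).toNNReal)) (I J : ι → ℝ≥0) :
    f I ≤ f J ↔ g I ≤ g J := by
  rw [hrep I, hrep J, hf.strictMono_constPt.le_iff_le (a := (g I / c).toNNReal),
    Real.toNNReal_le_toNNReal_iff (div_nonneg (hg0 J) hc.le), div_le_div_iff_of_pos_right hc]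

theorem Equivalent.eq_constPt (h : Equivalent f g) (hc : 0 < c) (hg0 : ∀ I, 0 ≤ g I)
    (hgc : ∀ s, g (constPt ι s) = c * s) (I : ι → ℝ≥0) :
    f I = f (constPt ι (g I / c).toNNReal) := by
  rw [h, hgc, Real.coe_toNNReal _ (div_nonneg (hg0 I) hc.le)]
  field_simp

theorem equivalent_of_le_iff (h : ∀ I J, f I ≤ f J ↔ g I ≤ g J) : Equivalent f g := fun I J => by
  rw [le_antisymm_iff, le_antisymm_iff, h, h]

theorem Equivalent.independence_iff [DecidableEq ι] (h : Equivalent f g) :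
    Independence f ↔ Independence g := by
  simp only [Independence, h _ _]

theorem Equivalent.scaleInvariance_iff (h : Equivalent f g) :
    ScaleInvariance f ↔ ScaleInvariance g := by
  simp only [ScaleInvariance, h _ _]

theorem Equivalent.sufficientFunds_iff (h : Equivalent f g) :
    SufficientFunds f ↔ SufficientFunds g := by
  simp only [SufficientFunds, h _ _]

end

variable {ι : Type*} [Fintype ι] {f : (ι → ℝ≥0) → ℝ} {γ c : ℝ} {α : ι → ℝ}

/-- Equivalence only matches level sets, but each level set meets the diagonal, where both functions
increase, so the order agrees as well. This is what aversion to permanent loss needs. -/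
theorem Equivalent.le_iff_cemm [Nonempty ι] (h : Equivalent f (cemm γ c α))
    (hf : IsTradingFunction f) (hc : 0 < c) (hα : ∀ a, 0 < α a) (hsum : ∑ a, α a = 1)
    (I J : ι → ℝ≥0) : f I ≤ f J ↔ cemm γ c α I ≤ cemm γ c α J :=
  hf.le_iff hc (cemm_nonneg hc hα)
    (h.eq_constPt hc (cemm_nonneg hc hα) (cemm_const hα hsum)) I J

theorem Equivalent.aversion_iff [Nonempty ι] (h : Equivalent f (cemm γ c α))
    (hf : IsTradingFunction f) (hc : 0 < c) (hα : ∀ a, 0 < α a) (hsum : ∑ a, α a = 1) :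
    AversionToPermanentLoss f ↔ AversionToPermanentLoss (cemm γ c α) := by
  simp only [AversionToPermanentLoss, h.le_iff_cemm hf hc hα hsum]

theorem scaleInvariance_cemm (hα : ∀ a, 0 < α a) (hsum : ∑ a, α a = 1) :
    ScaleInvariance (cemm γ c α) := fun I J l hl h => by
  rw [cemm_smul hα hsum hl, cemm_smul hα hsum hl, h]

/-- A trading function on at least three assets is independent and scale invariant is
equivalent to a function of constant inventory elasticity. -/
theorem IsTradingFunction.exists_cemm [DecidableEq ι] (hf : IsTradingFunction f)
    (h3 : 2 < Fintype.card ι) (hi : Independence f) (hs : ScaleInvariance f) :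
    ∃ (γ : ℝ) (α : ι → ℝ), (∀ a, 0 < α a) ∧ ∑ a, α a = 1 ∧ Equivalent f (cemm γ 1 α) := by
  have : Nonempty ι := Fintype.card_pos_iff.1 (by omega)
  obtain ⟨γ, α, hα, hsum, hle⟩ := (hf.isLogTrading hi hs).exists_totalUtil h3
  have hrep := hf.eq_constPt one_pos (continuous_cemm (γ := γ) one_pos hα)
    (cemm_nonneg one_pos hα) (cemm_const hα hsum) (by
      intro I J hI hJ
      have h1 := hle (fun a => Real.log (I a)) (fun a => Real.log (J a))
      have h2 := cemm_expPt_le_iff (γ := γ) one_pos hα (fun a => Real.log (I a))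
        (fun a => Real.log (J a))
      rw [expPt_log hI, expPt_log hJ] at h1 h2
      exact h1.trans h2.symm)
  exact ⟨γ, α, hα, hsum, equivalent_of_le_iff (hf.le_iff one_pos (cemm_nonneg one_pos hα) hrep)⟩

theorem elasticity_mem_iff (γ : ℝ) : (0 < elasticity γ ∧ elasticity γ ≤ 1) ↔ γ ≤ 0 := by
  unfold elasticity
  constructor
  · rintro ⟨h0, h1⟩
    -- The case γ = 1, where division by zero returns 0, is excluded by strict positivity.
    have h2 : 0 < 1 - γ := one_div_pos.1 h0
    rw [div_le_one h2] at h1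
    linarith
  · intro h
    have h2 : 0 < 1 - γ := by linarith
    exact ⟨one_div_pos.2 h2, (div_le_one h2).2 (by linarith)⟩

end

end CFMM

theorem mainTheorem3 {ι : Type*} [Fintype ι] [DecidableEq ι] (hcard : 2 < Fintype.card ι)
    (f : (ι → ℝ≥0) → ℝ) (hf : CFMM.IsTradingFunction f) :
    ((CFMM.Independence f ∧ CFMM.ScaleInvariance f ∧ CFMM.AversionToPermanentLoss f) ↔
      ∃ (γ : ℝ) (g : (ι → ℝ≥0) → ℝ),
        CFMM.HasPositiveElasticity γ ∧ CFMM.IsCEMM γ g ∧ CFMM.Equivalent f g) ∧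
    ((CFMM.Independence f ∧ CFMM.ScaleInvariance f ∧ CFMM.SufficientFunds f) ↔
      ∃ (γ : ℝ) (g : (ι → ℝ≥0) → ℝ),
        (0 < CFMM.elasticity γ ∧ CFMM.elasticity γ ≤ 1) ∧
          CFMM.IsCEMM γ g ∧ CFMM.Equivalent f g) := by
  have : Nontrivial ι := Fintype.one_lt_card_iff_nontrivial.1 (by omega)
  refine ⟨⟨?_, ?_⟩, ⟨?_, ?_⟩⟩
  · rintro ⟨hi, hs, ha⟩
    obtain ⟨γ, α, hα, hsum, he⟩ := hf.exists_cemm hcard hi hs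
    rw [he.aversion_iff hf one_pos hα hsum] at ha
    exact ⟨γ, _, CFMM.le_one_of_aversion one_pos hα ha, ⟨1, α, one_pos, hα, hsum, rfl⟩, he⟩
  · rintro ⟨γ, _, hγ, ⟨c, α, hc, hα, hsum, rfl⟩, he⟩
    rw [he.independence_iff, he.scaleInvariance_iff, he.aversion_iff hf hc hα hsum]
    exact ⟨CFMM.independence_cemm hc hα, CFMM.scaleInvariance_cemm hα hsum,
      CFMM.convex_cemm hγ hc hα⟩
  · rintro ⟨hi, hs, ha⟩
    obtain ⟨γ, α, hα, hsum, he⟩ := hf.exists_cemm hcard hi hs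
    rw [he.sufficientFunds_iff, CFMM.sufficientFunds_cemm_iff one_pos hα hsum] at ha
    exact ⟨γ, _, (CFMM.elasticity_mem_iff γ).2 ha, ⟨1, α, one_pos, hα, hsum, rfl⟩, he⟩
  · rintro ⟨γ, _, hγ, ⟨c, α, hc, hα, hsum, rfl⟩, he⟩
    rw [he.independence_iff, he.scaleInvariance_iff, he.sufficientFunds_iff]
    exact ⟨CFMM.independence_cemm hc hα, CFMM.scaleInvariance_cemm hα hsum,
      (CFMM.sufficientFunds_cemm_iff hc hα hsum).2 ((CFMM.elasticity_mem_iff γ).1 hγ)⟩
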